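/- Conventions. A polygon is a simple polygon in the Euclidean plane with vertices $v_1,\dots,v_n$ ($n\ge 3$) in cyclic order. Two vertices are visible (see each other) if the closed segment joining them is contained in the closed polygon; a visible pair of distinct non-adjacent vertices is a diagonal. The polygon is in general position if the open segment of every diagonal is contained in the open polygon. It is deflated if no two distinct edges of its visibility graph (the open segments joining visible pairs of distinct vertices, polygon edges included) intersect. A deformation of $P$ assigns to each vertex $v$ a continuous path $t\mapsto v^t$, $t\in[0,1]$, in the plane with $v^0=v$, such that the polygon $P^t$ formed by the vertices $v^t$, joined as in $P$, is simple for all $t$. It is monotonic if there are no vertices $u,v$ and times $s<t$ such that $u^t,v^t$ are visible in $P^t$ but $u^s,v^s$ are not visible in $P^s$. A deflation of $P$ is a monotonic deformation of $P$ such that $P^1$ is deflated; $P$ is deflatable if it has a deflation. Theorem. The vertex-vertex visibilities of a polygon do not determine its deflatability: there exist $n$ and two simple polygons $P$, with vertices $p_1,\dots,p_n$ in cyclic order, and $Q$, with vertices $q_1,\dots,q_n$ in cyclic order, both in general position, such that for all $i,j$ the vertices $p_i,p_j$ are visible in $P$ if and only if $q_i,q_j$ are visible in $Q$, and such that $P$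 is not deflatable while $Q$ is deflatable. Moreover, $Q$ has a deflation that moves only one vertex $u$ and moves it through a diagonal $f$ of $Q$: at some time $u$ lies on the open segment $f$, and the initial and final positions of $u$ lie strictly on opposite sides of the line containing $f$. -/

import Mathlib

open Set

namespace PolygonDeflation

/-- The Euclidean plane. -/
abbrev Plane : Type := EuclideanSpace ℝ (Fin 2)

variable {n : ℕ}

/-- A simple polygon: at least three vertices, pairwise distinct, and two distinct edges
meet only in a common endpoint. The edge with index `i` joins vertex `i` to its cyclic successor
`finRotate n i`. -/
def IsSimple (P : Polygon Plane n) : Prop :=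
  3 ≤ n ∧ Function.Injective P.vertices ∧
    ∀ i j : Fin n, i ≠ j →
      P.edgeSet ℝ i ∩ P.edgeSet ℝ j ⊆
        {P i, P (finRotate n i)} ∩ {P j, P (finRotate n j)}

/-- The open polygon: the points off the boundary curve whose connected component in the
complement of the boundary curve is bounded. -/
def openRegion (P : Polygon Plane n) : Set Plane :=
  {x | x ∈ (P.boundary ℝ)ᶜ ∧ Bornology.IsBounded (connectedComponentIn (P.boundary ℝ)ᶜ x)}

/-- The closed polygon: the boundary curve together with the open polygon. -/
def closedRegion (P : Polygon Plane n) : Set Plane :=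
  P.boundary ℝ ∪ openRegion P

/-- Two vertices see each other if the closed segment joining them lies in the closed polygon. -/
def Visible (P : Polygon Plane n) (i j : Fin n) : Prop :=
  segment ℝ (P i) (P j) ⊆ closedRegion P

/-- Two vertices are adjacent if they are the endpoints of an edge of the polygon. -/
def Adjacent (i j : Fin n) : Prop :=
  finRotate n i = j ∨ finRotate n j = i

/-- `i` and `j` span a diagonal: they are distinct, not adjacent, and see each other. -/
def IsDiagonal (P : Polygon Plane n) (i j : Fin n) : Prop :=
  i ≠ j ∧ ¬ Adjacent i j ∧ Visible P i j

/-- General position: the open segment joining two visible vertices lies in the open polygon.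
(Endpoints of a polygon edge, whose segment always lies on the boundary, are of course exempt.) -/
def GeneralPosition (P : Polygon Plane n) : Prop :=
  ∀ i j : Fin n, IsDiagonal P i j → openSegment ℝ (P i) (P j) ⊆ openRegion P

/-- A polygon is deflated if no two distinct edges of its visibility graph (open segments joining
visible pairs of distinct vertices, polygon edges included) intersect. -/
def IsDeflated (P : Polygon Plane n) : Prop :=
  ∀ i j k l : Fin n, i ≠ j → k ≠ l → s(i, j) ≠ s(k, l) → Visible P i j → Visible P k l →
    Disjoint (openSegment ℝ (P i) (P j)) (openSegment ℝ (P k) (P l))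

/-- A deformation of `P`: every vertex moves continuously over the time interval `[0,1]`,
starting from `P`, and the polygon is simple at all times. -/
def IsDeformation (P : Polygon Plane n) (γ : unitInterval → Polygon Plane n) : Prop :=
  γ 0 = P ∧ (∀ i : Fin n, Continuous fun t => γ t i) ∧ ∀ t, IsSimple (γ t)

/-- A monotonic deformation: no two vertices ever become visible. -/
def IsMonotonicDeformation (P : Polygon Plane n) (γ : unitInterval → Polygon Plane n) : Prop :=
  IsDeformation P γ ∧
    ∀ (i j : Fin n) (s t : unitInterval), s < t → Visible (γ t) i j → Visible (γ s) i j

/-- A deflation: a monotonic deformation that ends in a deflated polygon. -/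
def IsDeflation (P : Polygon Plane n) (γ : unitInterval → Polygon Plane n) : Prop :=
  IsMonotonicDeformation P γ ∧ IsDeflated (γ 1)

/-- A polygon is deflatable if it has a deflation. -/
def IsDeflatable (P : Polygon Plane n) : Prop :=
  ∃ γ : unitInterval → Polygon Plane n, IsDeflation P γ

/-- The motion `γ` of `P` moves only the vertex `u`, and moves it through the diagonal with
endpoints `a` and `b`: at some time `u` lies on the open diagonal, and the initial and final
positions of `u` are strictly on opposite sides of the line carrying it. -/
def MovesOnlyThrough (P : Polygon Plane n) (γ : unitInterval → Polygon Plane n)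
    (u a b : Fin n) : Prop :=
  (∀ (t : unitInterval) (i : Fin n), i ≠ u → γ t i = P i) ∧
    IsDiagonal P a b ∧
    (∃ t, γ t u ∈ openSegment ℝ (P a) (P b)) ∧
    (affineSpan ℝ {P a, P b}).SOppSide (P u) (γ 1 u)

end PolygonDeflation

namespace PolygonDeflation

open Filter Topology Metric

/-! ### The boundary curve and membership in the closed polygon -/

theorem edgeSet_eq_segment (P : Polygon Plane n) (i : Fin n) :
    P.edgeSet ℝ i = segment ℝ (P i) (P (finRotate n i)) := by
  rw [Polygon.edgeSet, affineSegment_eq_segment]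

theorem edge_subset_boundary (P : Polygon Plane n) (i : Fin n) :
    segment ℝ (P i) (P (finRotate n i)) ⊆ P.boundary ℝ := by
  rw [← edgeSet_eq_segment]
  exact subset_iUnion (fun i => P.edgeSet ℝ i) i

theorem mem_boundary {P : Polygon Plane n} {x : Plane} :
    x ∈ P.boundary ℝ ↔ ∃ i, x ∈ segment ℝ (P i) (P (finRotate n i)) := by
  simp only [Polygon.boundary, mem_iUnion, edgeSet_eq_segment]

theorem isCompact_boundary (P : Polygon Plane n) : IsCompact (P.boundary ℝ) := by
  refine isCompact_iUnion fun i => ?_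
  rw [edgeSet_eq_segment, segment_eq_image_lineMap]
  exact isCompact_Icc.image AffineMap.lineMap_continuous

theorem boundary_subset_of_convex {P : Polygon Plane n} {s : Set Plane} (hs : Convex ℝ s)
    (h : ∀ i, P i ∈ s) : P.boundary ℝ ⊆ s := by
  intro x hx
  obtain ⟨i, hi⟩ := mem_boundary.1 hx
  exact hs.segment_subset (h _) (h _) hi

/-- A closed bounded set all of whose frontier lies on the boundary curve is part of the
closed polygon. -/
theorem subset_closedRegion {P : Polygon Plane n} {K : Set Plane} (hb : Bornology.IsBounded K)
    (hc : IsClosed K) (h : ∀ x ∈ K, x ∈ P.boundary ℝ ∨ K ∈ 𝓝 x) : K ⊆ closedRegion P := by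
  intro x hx
  by_cases hxb : x ∈ P.boundary ℝ
  · exact Or.inl hxb
  refine Or.inr ⟨hxb, hb.subset (Subset.trans ?_ interior_subset)⟩
  -- Off the boundary curve every point of `K` is interior to `K`, so the component of `x` is
  -- covered by the disjoint open sets `interior K` and `Kᶜ`; being connected, it stays in the
  -- first.
  refine (isPreconnected_connectedComponentIn (x := x)).subset_left_of_subset_union
    isOpen_interior hc.isOpen_compl ?_ ?_ ?_
  · exact disjoint_compl_right.mono_left interior_subset
  · intro y hy
    have hyb := connectedComponentIn_subset _ _ hy
    by_cases hyK : y ∈ K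
    · exact Or.inl (mem_interior_iff_mem_nhds.2 ((h y hyK).resolve_left hyb))
    · exact Or.inr hyK
  · exact ⟨x, mem_connectedComponentIn hxb,
      mem_interior_iff_mem_nhds.2 ((h x hx).resolve_left hxb)⟩

theorem notMem_closedRegion_of_isPreconnected {P : Polygon Plane n} {S : Set Plane} {x : Plane}
    (hS : IsPreconnected S) (hx : x ∈ S) (hd : Disjoint S (P.boundary ℝ))
    (hu : ¬ Bornology.IsBounded S) : x ∉ closedRegion P := by
  rintro (h | ⟨-, h⟩)
  · exact disjoint_left.1 hd hx h
  · exact hu (h.subset (hS.subset_connectedComponentIn hx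
      (subset_compl_iff_disjoint_right.2 hd)))

theorem isPreconnected_ray (x d : Plane) :
    IsPreconnected ((fun r : ℝ => x + r • d) '' Ici 0) :=
  isPreconnected_Ici.image _ (by fun_prop)

theorem not_isBounded_ray (x : Plane) {d : Plane} (hd : d ≠ 0) :
    ¬ Bornology.IsBounded ((fun r : ℝ => x + r • d) '' Ici 0) := by
  intro h
  obtain ⟨C, hC⟩ := h.exists_norm_le
  have hd' : 0 < ‖d‖ := norm_pos_iff.2 hd
  have hC0 : 0 ≤ C := (norm_nonneg _).trans (hC (x + (0 : ℝ) • d) ⟨0, by simp, rfl⟩)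
  set r := (C + ‖x‖ + 1) / ‖d‖
  have hr : 0 ≤ r := by positivity
  have h1 := hC (x + r • d) ⟨r, hr, rfl⟩
  have h2 : ‖r • d‖ ≤ ‖x + r • d‖ + ‖x‖ := by
    have := norm_sub_le (x + r • d) x
    simpa using this
  rw [norm_smul, Real.norm_of_nonneg hr, div_mul_cancel₀ _ hd'.ne'] at h2
  linarith

/-- A point from which a ray escapes without meeting the boundary curve is not in the closed
polygon. -/
theorem notMem_closedRegion_of_ray {P : Polygon Plane n} {x d : Plane} (hd : d ≠ 0)
    (h : ∀ r : ℝ, 0 ≤ r → x + r • d ∉ P.boundary ℝ) : x ∉ closedRegion P := by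
  refine notMem_closedRegion_of_isPreconnected (isPreconnected_ray x d) ⟨0, by simp, by simp⟩ ?_
    (not_isBounded_ray x hd)
  rw [disjoint_left]
  rintro _ ⟨r, hr, rfl⟩
  exact h r hr

/-! ### Visibility as a closed condition in time -/

theorem boundary_subset_thickening {P Q : Polygon Plane n} {δ : ℝ}
    (h : ∀ i, dist (P i) (Q i) < δ) : P.boundary ℝ ⊆ thickening δ (Q.boundary ℝ) := by
  intro x hx
  obtain ⟨i, a, b, ha, hb, hab, rfl⟩ := mem_boundary.1 hx
  refine mem_thickening_iff.2 ⟨a • Q i + b • Q (finRotate n i),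
    mem_boundary.2 ⟨i, a, b, ha, hb, hab, rfl⟩, ?_⟩
  rw [dist_eq_norm, ← mem_ball_zero_iff]
  have e : a • P i + b • P (finRotate n i) - (a • Q i + b • Q (finRotate n i)) =
      a • (P i - Q i) + b • (P (finRotate n i) - Q (finRotate n i)) := by module
  rw [e]
  refine convex_ball (0 : Plane) δ ?_ ?_ ha hb hab <;>
    rw [mem_ball_zero_iff, ← dist_eq_norm] <;> exact h _

/-- Membership in the closed polygon is a closed condition, jointly in the point and in the
parameter of a continuous family of polygons. -/
theorem isClosed_mem_closedRegion {X : Type*} [TopologicalSpace X] {γ : X → Polygon Plane n}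
    (hγ : ∀ i, Continuous fun t => γ t i) :
    IsClosed {p : X × Plane | p.2 ∈ closedRegion (γ p.1)} := by
  rw [← isOpen_compl_iff, isOpen_iff_mem_nhds]
  rintro ⟨t₀, x₀⟩ hx₀
  change x₀ ∉ closedRegion (γ t₀) at hx₀
  have hxb : x₀ ∈ ((γ t₀).boundary ℝ)ᶜ := fun h => hx₀ (Or.inl h)
  set C := connectedComponentIn ((γ t₀).boundary ℝ)ᶜ x₀ with hC
  have hCu : ¬ Bornology.IsBounded C := fun h => hx₀ (Or.inr ⟨hxb, h⟩)
  have hCo : IsOpen C := (isCompact_boundary _).isClosed.isOpen_compl.connectedComponentIn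
  have hCc : IsConnected C := isConnected_connectedComponentIn_iff.2 hxb
  have hCp : IsPathConnected C := hCo.isConnected_iff_isPathConnected.1 hCc
  set M : ℝ := ∑ i, ‖γ t₀ i‖ + 1
  have hM : ∀ i, ‖γ t₀ i‖ < M := fun i =>
    (Finset.single_le_sum (f := fun i => ‖γ t₀ i‖) (fun _ _ => norm_nonneg _)
      (Finset.mem_univ i)).trans_lt (lt_add_one _)
  have hM0 : 0 < M := by positivity
  -- The escape route from `x₀` is a path to a point `y` beyond all vertices, followed by the radial
  -- ray from `y`. Nearby boundary curves miss a thickening of the path and stay in the ball of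
  -- radius `M`, so the same route works for nearby polygons.
  obtain ⟨y, hyC, hyM⟩ : ∃ y ∈ C, M < ‖y‖ := by
    by_contra! h
    exact hCu (isBounded_iff_forall_norm_le.2 ⟨M, h⟩)
  obtain ⟨p, hp⟩ := hCp.joinedIn x₀ (mem_connectedComponentIn hxb) y hyC
  have hdis : Disjoint (range p) ((γ t₀).boundary ℝ) := by
    rw [disjoint_left]
    rintro _ ⟨s, rfl⟩
    exact connectedComponentIn_subset _ _ (hp s)
  obtain ⟨δ, hδ, hth⟩ := hdis.exists_thickenings (isCompact_range p.continuous)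
    (isCompact_boundary _).isClosed
  have ev1 : ∀ᶠ t in 𝓝 t₀, ∀ i, ‖γ t i‖ < M :=
    eventually_all.2 fun i => ((hγ i).norm.tendsto t₀).eventually_lt_const (hM i)
  have ev2 : ∀ᶠ t in 𝓝 t₀, ∀ i, dist (γ t i) (γ t₀ i) < δ :=
    eventually_all.2 fun i => ((hγ i).tendsto t₀).eventually (ball_mem_nhds _ hδ)
  have ev3 : ∀ᶠ x in 𝓝 x₀, x ∈ ball x₀ δ := ball_mem_nhds x₀ hδ
  filter_upwards [(ev1.and ev2).prod_nhds ev3]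
  rintro ⟨t, x⟩ ⟨⟨h1, h2⟩, hx⟩
  change x ∉ closedRegion (γ t)
  have hray := isPreconnected_ray y y
  have hmem : y ∈ (fun r : ℝ => y + r • y) '' Ici 0 := ⟨0, by simp, by simp⟩
  have hy0 : y ≠ 0 := norm_pos_iff.1 (hM0.trans hyM)
  have hrange : IsPreconnected (range p) := isPreconnected_range p.continuous
  refine notMem_closedRegion_of_isPreconnected
    (S := ball x₀ δ ∪ (range p ∪ (fun r : ℝ => y + r • y) '' Ici 0)) ?_ (Or.inl hx) ?_ ?_
  · refine IsPreconnected.union x₀ (mem_ball_self hδ) (Or.inl (show x₀ ∈ range p from ⟨0, p.source⟩))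
      (convex_ball _ _).isPreconnected ?_
    exact IsPreconnected.union y ⟨1, p.target⟩ hmem hrange hray
  · have hb : (γ t).boundary ℝ ⊆ thickening δ ((γ t₀).boundary ℝ) :=
      boundary_subset_thickening h2
    have hd := (hth.mono_right hb)
    refine Disjoint.union_left (hd.mono_left ?_) (Disjoint.union_left (hd.mono_left ?_) ?_)
    · exact ball_subset_thickening (show x₀ ∈ range p from ⟨0, p.source⟩) δ
    · exact self_subset_thickening hδ _
    · have hball : (γ t).boundary ℝ ⊆ ball 0 M :=
        boundary_subset_of_convex (convex_ball _ _) fun i => by simpa using h1 i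
      refine Disjoint.mono_right hball ?_
      rw [disjoint_left]
      rintro _ ⟨r, hr, rfl⟩ hr'
      have hr0 : (0 : ℝ) ≤ r := hr
      have e : y + r • y = (1 + r) • y := by module
      simp only [mem_ball_zero_iff, e, norm_smul, Real.norm_of_nonneg (by linarith : 0 ≤ 1 + r)]
        at hr'
      nlinarith [norm_nonneg y]
  · exact fun h => not_isBounded_ray y hy0
      (h.subset (subset_union_right.trans subset_union_right))

theorem isClosed_setOf_mem_closedRegion {X : Type*} [TopologicalSpace X]
    {γ : X → Polygon Plane n} (hγ : ∀ i, Continuous fun t => γ t i) {x : X → Plane}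
    (hx : Continuous x) : IsClosed {t | x t ∈ closedRegion (γ t)} :=
  (isClosed_mem_closedRegion hγ).preimage (continuous_id.prodMk hx)

/-! ### Orientations, triangles and collinear points -/

/-- Twice the signed area of the triangle `p q r`: positive if it is traversed
counterclockwise. -/
def turn (p q r : Plane) : ℝ := (q 0 - p 0) * (r 1 - p 1) - (q 1 - p 1) * (r 0 - p 0)

theorem turn_rotate (p q r : Plane) : turn q r p = turn p q r := by unfold turn; ring

theorem turn_rotate' (p q r : Plane) : turn p q r = turn r p q := by unfold turn; ring

theorem turn_swap (p q r : Plane) : turn q p r = -turn p q r := by unfold turn; ring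

theorem turn_swap_right (p q r : Plane) : turn p r q = -turn p q r := by unfold turn; ring

theorem turn_combo {a b : ℝ} (hab : a + b = 1) (p q x y : Plane) :
    turn p q (a • x + b • y) = a * turn p q x + b * turn p q y := by
  obtain rfl : a = 1 - b := by linarith
  simp only [turn, PiLp.add_apply, PiLp.smul_apply, smul_eq_mul]
  ring

theorem turn_combo_left {a b : ℝ} (hab : a + b = 1) (p q x y : Plane) :
    turn (a • x + b • y) p q = a * turn x p q + b * turn y p q := by
  rw [← turn_rotate, turn_combo hab, turn_rotate x, turn_rotate y]

theorem turn_combo_mid {a b : ℝ} (hab : a + b = 1) (p q x y : Plane) :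
    turn p (a • x + b • y) q = a * turn p x q + b * turn p y q := by
  rw [turn_rotate', turn_combo hab, ← turn_rotate' p, ← turn_rotate' p]

theorem turn_self_left (p q : Plane) : turn p q p = 0 := by unfold turn; ring

theorem turn_self_right (p q : Plane) : turn p q q = 0 := by unfold turn; ring

theorem turn_self (p q : Plane) : turn p p q = 0 := by unfold turn; ring

theorem continuous_turn {X : Type*} [TopologicalSpace X] {f g h : X → Plane}
    (hf : Continuous f) (hg : Continuous g) (hh : Continuous h) :
    Continuous fun t => turn (f t) (g t) (h t) := by
  unfold turn
  fun_prop

theorem convex_turn_nonneg (p q : Plane) : Convex ℝ {x | 0 ≤ turn p q x} := by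
  intro x hx y hy a b ha hb hab
  simp only [mem_ofPred_eq, turn_combo hab] at *
  positivity

/-- The closed triangle `p q r`, for vertices in counterclockwise order. -/
def tri (p q r : Plane) : Set Plane := {x | 0 ≤ turn p q x ∧ 0 ≤ turn q r x ∧ 0 ≤ turn r p x}

theorem convex_tri (p q r : Plane) : Convex ℝ (tri p q r) :=
  (convex_turn_nonneg p q).inter ((convex_turn_nonneg q r).inter (convex_turn_nonneg r p))

theorem isClosed_tri (p q r : Plane) : IsClosed (tri p q r) := by
  have h (p q : Plane) : IsClosed {x | 0 ≤ turn p q x} :=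
    isClosed_le continuous_const (continuous_turn continuous_const continuous_const continuous_id)
  exact (h p q).inter ((h q r).inter (h r p))

theorem tri_rotate (p q r : Plane) : tri q r p = tri p q r := by
  ext x
  simp only [tri, mem_ofPred_eq]
  tauto

theorem left_mem_tri {p q r : Plane} (h : 0 ≤ turn p q r) : p ∈ tri p q r := by
  refine ⟨(turn_self_left p q).ge, ?_, (turn_self_right r p).ge⟩
  rwa [turn_rotate]

theorem segment_subset_tri {p q r : Plane} (h : 0 ≤ turn p q r) : segment ℝ p q ⊆ tri p q r := by
  refine (convex_tri p q r).segment_subset (left_mem_tri h) ?_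
  rw [← tri_rotate]
  exact left_mem_tri (by rwa [turn_rotate])

/-- The three orientations at `x` are its barycentric coordinates scaled by `turn p q r`; avoiding
the division keeps the identity valid for degenerate triangles. -/
theorem smul_eq_barycentric (p q r x : Plane) :
    turn p q r • x = turn q r x • p + turn r p x • q + turn p q x • r := by
  ext i
  fin_cases i <;> simp [turn] <;> ring

theorem turn_add_turn_add_turn (p q r x : Plane) :
    turn q r x + turn r p x + turn p q x = turn p q r := by unfold turn; ring

theorem isBounded_tri {p q r : Plane} (h : 0 < turn p q r) : Bornology.IsBounded (tri p q r) := by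
  refine isBounded_iff_forall_norm_le.2 ⟨‖p‖ + ‖q‖ + ‖r‖, fun x ⟨h1, h2, h3⟩ => ?_⟩
  have e := congrArg norm (smul_eq_barycentric p q r x)
  have t := norm_add₃_le (a := turn q r x • p) (b := turn r p x • q) (c := turn p q x • r)
  rw [← e] at t
  simp only [norm_smul, Real.norm_of_nonneg h1, Real.norm_of_nonneg h2, Real.norm_of_nonneg h3,
    Real.norm_of_nonneg h.le] at t
  have s := turn_add_turn_add_turn p q r x
  have b1 := mul_le_mul_of_nonneg_right (by linarith : turn q r x ≤ turn p q r) (norm_nonneg p)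
  have b2 := mul_le_mul_of_nonneg_right (by linarith : turn r p x ≤ turn p q r) (norm_nonneg q)
  have b3 := mul_le_mul_of_nonneg_right (by linarith : turn p q x ≤ turn p q r) (norm_nonneg r)
  exact le_of_mul_le_mul_left (by linarith) h

theorem mem_segment_of_mem_tri {p q r x : Plane} (h : 0 < turn p q r) (hx : x ∈ tri p q r)
    (h0 : turn p q x = 0) : x ∈ segment ℝ p q := by
  refine ⟨turn q r x / turn p q r, turn r p x / turn p q r, div_nonneg hx.2.1 h.le,
    div_nonneg hx.2.2 h.le, ?_, ?_⟩
  · rw [← add_div, div_eq_one_iff_eq h.ne', ← turn_add_turn_add_turn p q r x, h0, add_zero]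
  · have e := smul_eq_barycentric p q r x
    rw [h0, zero_smul, add_zero] at e
    rw [div_eq_inv_mul, div_eq_inv_mul, mul_smul, mul_smul, ← smul_add, ← e,
      inv_smul_smul₀ h.ne']

theorem eventually_turn_pos {p q x : Plane} (h : 0 < turn p q x) : ∀ᶠ y in 𝓝 x, 0 < turn p q y :=
  (continuous_turn continuous_const continuous_const continuous_id).tendsto x |>.eventually_const_lt h

theorem tri_mem_nhds_or {p q r x : Plane} (h : 0 < turn p q r) (hx : x ∈ tri p q r) :
    tri p q r ∈ 𝓝 x ∨ x ∈ segment ℝ p q ∨ x ∈ segment ℝ q r ∨ x ∈ segment ℝ r p := by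
  rcases hx.1.eq_or_lt with h1 | h1
  · exact Or.inr (Or.inl (mem_segment_of_mem_tri h hx h1.symm))
  rcases hx.2.1.eq_or_lt with h2 | h2
  · refine Or.inr (Or.inr (Or.inl (mem_segment_of_mem_tri (r := p) ?_ ?_ h2.symm)))
    · rwa [turn_rotate]
    · rwa [tri_rotate]
  rcases hx.2.2.eq_or_lt with h3 | h3
  · refine Or.inr (Or.inr (Or.inr (mem_segment_of_mem_tri (r := q) ?_ ?_ h3.symm)))
    · rwa [turn_rotate, turn_rotate]
    · rwa [tri_rotate, tri_rotate]
  left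
  filter_upwards [eventually_turn_pos h1, eventually_turn_pos h2, eventually_turn_pos h3]
    with y a b c using ⟨a.le, b.le, c.le⟩

/-- Two triangles on opposite sides of a common side surround each interior point of that side: the
four conditions from the other sides are strict there, and the sign of `turn p q` selects the
triangle. -/
theorem union_tri_mem_nhds {p q r s x : Plane} (hr : 0 < turn p q r) (hs : 0 < turn q p s)
    (hx : x ∈ segment ℝ p q) : x = p ∨ x = q ∨ tri p q r ∪ tri q p s ∈ 𝓝 x := by
  obtain ⟨a, b, ha, hb, hab, rfl⟩ := hx
  rcases hb.eq_or_lt with rfl | hb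
  · left
    obtain rfl : a = 1 := by linarith
    simp
  rcases ha.eq_or_lt with rfl | ha
  · right; left
    obtain rfl : b = 1 := by linarith
    simp
  right; right
  have e1 : 0 < turn q r (a • p + b • q) := by
    rw [turn_combo hab, turn_self_left, turn_rotate]; positivity
  have e2 : 0 < turn r p (a • p + b • q) := by
    rw [turn_combo hab, turn_self_right, turn_rotate, turn_rotate]; positivity
  have e3 : 0 < turn p s (a • p + b • q) := by
    rw [turn_combo hab, turn_self_left, turn_rotate]; positivity
  have e4 : 0 < turn s q (a • p + b • q) := by
    rw [turn_combo hab, turn_self_right, turn_rotate, turn_rotate]; positivity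
  filter_upwards [eventually_turn_pos e1, eventually_turn_pos e2, eventually_turn_pos e3,
    eventually_turn_pos e4] with y h1 h2 h3 h4
  rcases le_total 0 (turn p q y) with h | h
  · exact Or.inl ⟨h, h1.le, h2.le⟩
  · exact Or.inr ⟨by rw [turn_swap]; linarith, h3.le, h4.le⟩

theorem mem_segment_of_turn_eq_zero {p q r : Plane} (h : turn p q r = 0) :
    p ∈ segment ℝ q r ∨ q ∈ segment ℝ p r ∨ r ∈ segment ℝ p q := by
  have hcol : Collinear ℝ {p, q, r} := by
    by_cases hpq : p = q
    · subst hpq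
      simpa using collinear_pair ℝ p r
    rw [collinear_iff_of_mem (p₀ := p) (by simp)]
    refine ⟨q - p, ?_⟩
    have hN : (q 0 - p 0) ^ 2 + (q 1 - p 1) ^ 2 ≠ 0 := by
      intro h0
      obtain ⟨h0, h1⟩ := (add_eq_zero_iff_of_nonneg (sq_nonneg _) (sq_nonneg _)).1 h0
      apply hpq
      ext i
      fin_cases i
      · exact (sub_eq_zero.1 (pow_eq_zero_iff two_ne_zero |>.1 h0)).symm
      · exact (sub_eq_zero.1 (pow_eq_zero_iff two_ne_zero |>.1 h1)).symm
    simp only [mem_insert_iff, mem_singleton_iff, forall_eq_or_imp, forall_eq, vadd_eq_add]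
    -- The coefficient for `r` is that of the orthogonal projection of `r - p` onto `q - p`.
    refine ⟨⟨0, by simp⟩, ⟨1, by rw [one_smul, sub_add_cancel]⟩, ((r 0 - p 0) * (q 0 - p 0) + (r 1 - p 1) * (q 1 - p 1)) /
      ((q 0 - p 0) ^ 2 + (q 1 - p 1) ^ 2), ?_⟩
    unfold turn at h
    ext i
    fin_cases i
    · simp only [Fin.zero_eta, PiLp.add_apply, PiLp.smul_apply, PiLp.sub_apply, smul_eq_mul]
      field_simp
      linear_combination (-(q 1 - p 1)) * h
    · simp only [Fin.mk_one, PiLp.add_apply, PiLp.smul_apply, PiLp.sub_apply, smul_eq_mul]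
      field_simp
      linear_combination (q 0 - p 0) * h
  rcases hcol.wbtw_or_wbtw_or_wbtw with h | h | h
  · exact Or.inr (Or.inl (mem_segment_iff_wbtw.2 h))
  · exact Or.inr (Or.inr (by rw [segment_symm]; exact mem_segment_iff_wbtw.2 h))
  · exact Or.inl (by rw [segment_symm]; exact mem_segment_iff_wbtw.2 h)

/-- Two segments with a common endpoint that lie on one line cover the segment between their
other endpoints. -/
theorem segment_subset_of_turn_eq_zero {p q r : Plane} {S : Set Plane} (h : turn p q r = 0)
    (h1 : segment ℝ p q ⊆ S) (h2 : segment ℝ q r ⊆ S) : segment ℝ p r ⊆ S := by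
  rcases mem_segment_of_turn_eq_zero h with h | h | h
  · refine Subset.trans ?_ h2
    exact (convex_segment q r).segment_subset h (right_mem_segment ℝ q r)
  · obtain ⟨a, b, ha, hb, hab, rfl⟩ := h
    rw [← insert_endpoints_openSegment]
    have hr : a • p + b • r ∈ range (AffineMap.lineMap p r : ℝ → Plane) :=
      ⟨b, by rw [AffineMap.lineMap_apply_module, ← hab]; simp⟩
    refine insert_subset (h1 (left_mem_segment _ _ _))
      (insert_subset (h2 (right_mem_segment _ _ _)) ((openSegment_subset_union p r hr).trans ?_))
    exact insert_subset (h1 (right_mem_segment _ _ _)) (union_subset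
      ((openSegment_subset_segment _ _ _).trans h1) ((openSegment_subset_segment _ _ _).trans h2))
  · refine Subset.trans ?_ h1
    exact (convex_segment p q).segment_subset (left_mem_segment ℝ p q) h

theorem Visible.symm {P : Polygon Plane n} {i j : Fin n} (h : Visible P i j) : Visible P j i := by
  rwa [Visible, segment_symm]

theorem boundary_subset_closedRegion (P : Polygon Plane n) : P.boundary ℝ ⊆ closedRegion P :=
  subset_union_left

theorem vertex_mem_boundary (P : Polygon Plane n) (i : Fin n) : P i ∈ P.boundary ℝ :=
  edge_subset_boundary P i (left_mem_segment _ _ _)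

theorem visible_self (P : Polygon Plane n) (i : Fin n) : Visible P i i := by
  rw [Visible, segment_same, singleton_subset_iff]
  exact boundary_subset_closedRegion P (vertex_mem_boundary P i)

theorem visible_edge (P : Polygon Plane n) (i : Fin n) : Visible P i (finRotate n i) :=
  (edge_subset_boundary P i).trans (boundary_subset_closedRegion P)

/-! ### Triangulated octagons and their visible pairs -/

/-- The octagon is cut by the diagonals `13`, `03`, `04`, `47`, `57` into counterclockwise
triangles. -/
structure IsTriangulated (P : Polygon Plane 8) : Prop where
  h013 : 0 < turn (P 0) (P 1) (P 3)
  h123 : 0 < turn (P 1) (P 2) (P 3)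
  h034 : 0 < turn (P 0) (P 3) (P 4)
  h047 : 0 < turn (P 0) (P 4) (P 7)
  h457 : 0 < turn (P 4) (P 5) (P 7)
  h567 : 0 < turn (P 5) (P 6) (P 7)

/-- The union of the triangles of the triangulation. -/
def triangleUnion (P : Polygon Plane 8) : Set Plane :=
  tri (P 0) (P 1) (P 3) ∪ tri (P 1) (P 2) (P 3) ∪ tri (P 0) (P 3) (P 4) ∪
    tri (P 0) (P 4) (P 7) ∪ tri (P 4) (P 5) (P 7) ∪ tri (P 5) (P 6) (P 7)

theorem mem_triangleUnion {P : Polygon Plane 8} {x : Plane} :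
    x ∈ triangleUnion P ↔ x ∈ tri (P 0) (P 1) (P 3) ∨ x ∈ tri (P 1) (P 2) (P 3) ∨
      x ∈ tri (P 0) (P 3) (P 4) ∨ x ∈ tri (P 0) (P 4) (P 7) ∨ x ∈ tri (P 4) (P 5) (P 7) ∨
      x ∈ tri (P 5) (P 6) (P 7) := by
  simp only [triangleUnion, mem_union, or_assoc]

theorem union_tri_mem_nhds_or {P : Polygon Plane n} {i j : Fin n} {r s x : Plane} {K : Set Plane}
    (hr : 0 < turn (P i) (P j) r) (hs : 0 < turn (P j) (P i) s) (h1 : tri (P i) (P j) r ⊆ K)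
    (h2 : tri (P j) (P i) s ⊆ K) (hx : x ∈ segment ℝ (P i) (P j)) :
    x ∈ P.boundary ℝ ∨ K ∈ 𝓝 x := by
  rcases union_tri_mem_nhds hr hs hx with rfl | rfl | h
  · exact Or.inl (vertex_mem_boundary P i)
  · exact Or.inl (vertex_mem_boundary P j)
  · exact Or.inr (mem_of_superset h (union_subset h1 h2))

/-- A point of a triangle is interior to it, on an edge of the octagon, or on one of the five
diagonals, where the two adjacent triangles form a neighbourhood away from the endpoints. This local
argument feeds `subset_closedRegion`; neither simplicity nor disjointness of the triangles matters.
-/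
theorem IsTriangulated.triangleUnion_subset {P : Polygon Plane 8} (h : IsTriangulated P) :
    triangleUnion P ⊆ closedRegion P := by
  obtain ⟨h013, h123, h034, h047, h457, h567⟩ := h
  have s013 : tri (P 0) (P 1) (P 3) ⊆ triangleUnion P := fun x hx => by
    simp only [mem_triangleUnion, hx, true_or]
  have s123 : tri (P 1) (P 2) (P 3) ⊆ triangleUnion P := fun x hx => by
    simp only [mem_triangleUnion, hx, true_or, or_true]
  have s034 : tri (P 0) (P 3) (P 4) ⊆ triangleUnion P := fun x hx => by
    simp only [mem_triangleUnion, hx, true_or, or_true]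
  have s047 : tri (P 0) (P 4) (P 7) ⊆ triangleUnion P := fun x hx => by
    simp only [mem_triangleUnion, hx, true_or, or_true]
  have s457 : tri (P 4) (P 5) (P 7) ⊆ triangleUnion P := fun x hx => by
    simp only [mem_triangleUnion, hx, true_or, or_true]
  have s567 : tri (P 5) (P 6) (P 7) ⊆ triangleUnion P := fun x hx => by
    simp only [mem_triangleUnion, hx, or_true]
  have d13 : ∀ x ∈ segment ℝ (P 1) (P 3), x ∈ P.boundary ℝ ∨ triangleUnion P ∈ 𝓝 x := fun x =>
    union_tri_mem_nhds_or (r := P 0) (s := P 2) (by rwa [turn_rotate])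
      (by rwa [← turn_rotate]) (by rwa [tri_rotate])
      (by rwa [← tri_rotate])
  have d03 : ∀ x ∈ segment ℝ (P 0) (P 3), x ∈ P.boundary ℝ ∨ triangleUnion P ∈ 𝓝 x := fun x =>
    union_tri_mem_nhds_or (r := P 4) (s := P 1) h034 (by rwa [← turn_rotate]) s034
      (by rwa [← tri_rotate])
  have d04 : ∀ x ∈ segment ℝ (P 0) (P 4), x ∈ P.boundary ℝ ∨ triangleUnion P ∈ 𝓝 x := fun x =>
    union_tri_mem_nhds_or (r := P 7) (s := P 3) h047 (by rwa [← turn_rotate]) s047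
      (by rwa [← tri_rotate])
  have d47 : ∀ x ∈ segment ℝ (P 4) (P 7), x ∈ P.boundary ℝ ∨ triangleUnion P ∈ 𝓝 x := fun x =>
    union_tri_mem_nhds_or (r := P 0) (s := P 5) (by rwa [turn_rotate]) (by rwa [← turn_rotate])
      (by rwa [tri_rotate]) (by rwa [← tri_rotate])
  have d57 : ∀ x ∈ segment ℝ (P 5) (P 7), x ∈ P.boundary ℝ ∨ triangleUnion P ∈ 𝓝 x := fun x =>
    union_tri_mem_nhds_or (r := P 4) (s := P 6) (by rwa [turn_rotate]) (by rwa [← turn_rotate])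
      (by rwa [tri_rotate]) (by rwa [← tri_rotate])
  refine subset_closedRegion ?_ ?_ ?_
  · exact (((((isBounded_tri h013).union (isBounded_tri h123)).union (isBounded_tri h034)).union
      (isBounded_tri h047)).union (isBounded_tri h457)).union (isBounded_tri h567)
  · exact ((((((isClosed_tri _ _ _).union (isClosed_tri _ _ _)).union (isClosed_tri _ _ _)).union
      (isClosed_tri _ _ _)).union (isClosed_tri _ _ _)).union (isClosed_tri _ _ _))
  · intro x hx
    rcases mem_triangleUnion.1 hx with hx | hx | hx | hx | hx | hx
    · rcases tri_mem_nhds_or h013 hx with h | h | h | h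
      · exact Or.inr (mem_of_superset h s013)
      · exact Or.inl (edge_subset_boundary P 0 h)
      · exact d13 x h
      · exact d03 x (by rwa [segment_symm])
    · rcases tri_mem_nhds_or h123 hx with h | h | h | h
      · exact Or.inr (mem_of_superset h s123)
      · exact Or.inl (edge_subset_boundary P 1 h)
      · exact Or.inl (edge_subset_boundary P 2 h)
      · exact d13 x (by rwa [segment_symm])
    · rcases tri_mem_nhds_or h034 hx with h | h | h | h
      · exact Or.inr (mem_of_superset h s034)
      · exact d03 x h
      · exact Or.inl (edge_subset_boundary P 3 h)
      · exact d04 x (by rwa [segment_symm])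
    · rcases tri_mem_nhds_or h047 hx with h | h | h | h
      · exact Or.inr (mem_of_superset h s047)
      · exact d04 x h
      · exact d47 x h
      · exact Or.inl (edge_subset_boundary P 7 h)
    · rcases tri_mem_nhds_or h457 hx with h | h | h | h
      · exact Or.inr (mem_of_superset h s457)
      · exact Or.inl (edge_subset_boundary P 4 h)
      · exact d57 x h
      · exact d47 x (by rwa [segment_symm])
    · rcases tri_mem_nhds_or h567 hx with h | h | h | h
      · exact Or.inr (mem_of_superset h s567)
      · exact Or.inl (edge_subset_boundary P 5 h)
      · exact Or.inl (edge_subset_boundary P 6 h)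
      · exact d57 x (by rwa [segment_symm])

/-- A quadrilateral is covered by the two triangles into which a diagonal cuts it. -/
theorem segment_subset_tri_union_tri {p q r s : Plane} (h1 : 0 ≤ turn p q s) (h2 : 0 ≤ turn q r s) :
    segment ℝ q s ⊆ tri p q r ∪ tri p r s := by
  rintro _ ⟨a, b, ha, hb, hab, rfl⟩
  rcases le_total 0 (turn p r (a • q + b • s)) with h | h
  · refine Or.inr ⟨h, ?_, ?_⟩
    · rw [turn_combo hab, turn_self_right, turn_rotate q r s]
      positivity
    · rw [turn_combo hab, turn_self_left, ← turn_rotate s p q]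
      positivity
  · refine Or.inl ⟨?_, ?_, ?_⟩
    · rw [turn_combo hab, turn_self_right]
      positivity
    · rw [turn_combo hab, turn_self_left]
      positivity
    · rw [turn_swap]
      linarith

theorem IsTriangulated.visible_three_seven {P : Polygon Plane 8} (h : IsTriangulated P)
    (h037 : 0 ≤ turn (P 0) (P 3) (P 7)) (h347 : 0 ≤ turn (P 3) (P 4) (P 7)) : Visible P 3 7 := by
  refine (segment_subset_tri_union_tri h037 h347).trans
    (Subset.trans ?_ h.triangleUnion_subset)
  rintro x (hx | hx) <;> simp only [mem_triangleUnion, hx, true_or, or_true]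

/-- The pairs of vertices of the octagons below that do not see each other. -/
def hiddenPairs : List (Fin 8 × Fin 8) :=
  [(0, 2), (0, 5), (0, 6), (1, 4), (1, 5), (1, 6), (1, 7), (2, 4), (2, 5), (2, 6), (2, 7),
    (3, 5), (3, 6), (4, 6)]

/-- Apart from 37, the pairs not listed as hidden are the eight edges and the five diagonals of the
triangulation, and each such diagonal is a side of a triangle. -/
theorem IsTriangulated.visible_of_notMem {P : Polygon Plane 8} (h : IsTriangulated P) {i j : Fin 8}
    (hij : i < j) (hn : (i, j) ∉ hiddenPairs) (h37 : (i, j) ≠ (3, 7)) : Visible P i j := by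
  have hs := h.triangleUnion_subset
  have v13 : Visible P 1 3 := fun x hx => hs (mem_triangleUnion.2 (Or.inl (by
    rw [← tri_rotate]; exact segment_subset_tri (by rw [turn_rotate]; exact h.h013.le) hx)))
  have v03 : Visible P 0 3 := fun x hx => hs (mem_triangleUnion.2 (Or.inr (Or.inr (Or.inl
    (segment_subset_tri h.h034.le hx)))))
  have v04 : Visible P 0 4 := fun x hx => hs (mem_triangleUnion.2 (Or.inr (Or.inr (Or.inr (Or.inl
    (segment_subset_tri h.h047.le hx))))))
  have v47 : Visible P 4 7 := fun x hx => hs (mem_triangleUnion.2 (Or.inr (Or.inr (Or.inr (Or.inl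
    (by rw [← tri_rotate]; exact segment_subset_tri (by rw [turn_rotate]; exact h.h047.le) hx))))))
  have v57 : Visible P 5 7 := fun x hx => hs (mem_triangleUnion.2 (Or.inr (Or.inr (Or.inr (Or.inr
    (Or.inl (by rw [← tri_rotate]; exact segment_subset_tri (by
      rw [turn_rotate]; exact h.h457.le) hx)))))))
  have key : ∀ i j : Fin 8, i < j → (i, j) ∉ hiddenPairs → (i, j) ≠ (3, 7) → j = i + 1 ∨
      (i = 0 ∧ j = 7) ∨ (i = 1 ∧ j = 3) ∨ (i = 0 ∧ j = 3) ∨ (i = 0 ∧ j = 4) ∨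
      (i = 4 ∧ j = 7) ∨ (i = 5 ∧ j = 7) := by decide
  rcases key i j hij hn h37 with rfl | ⟨rfl, rfl⟩ | ⟨rfl, rfl⟩ | ⟨rfl, rfl⟩ | ⟨rfl, rfl⟩ |
    ⟨rfl, rfl⟩ | ⟨rfl, rfl⟩
  · rw [← finRotate_apply]
    exact visible_edge P i
  · exact (visible_edge P 7).symm
  all_goals assumption

/-! ### Locked configurations -/

theorem IsSimple.vertex_notMem_edge {P : Polygon Plane n} (h : IsSimple P) (i j : Fin n)
    (hij : i ≠ j) (hij' : i ≠ finRotate n j) : P i ∉ segment ℝ (P j) (P (finRotate n j)) := by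
  intro hm
  rw [← edgeSet_eq_segment] at hm
  have hi : P i ∈ P.edgeSet ℝ i := by
    rw [edgeSet_eq_segment]
    exact left_mem_segment _ _ _
  rcases (h.2.2 i j hij ⟨hi, hm⟩).2 with e | e
  · exact hij (h.2.1 e)
  · exact hij' (h.2.1 e)

/-- `S` contains the closed, possibly degenerate, triangle `p q r`. -/
def Covers (S : Set Plane) (p q r : Plane) : Prop :=
  ∀ a b c : ℝ, 0 ≤ a → 0 ≤ b → 0 ≤ c → a + b + c = 1 → a • p + b • q + c • r ∈ S

theorem Covers.rotate {S : Set Plane} {p q r : Plane} (h : Covers S p q r) : Covers S q r p := by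
  intro a b c ha hb hc habc
  have := h c a b hc ha hb (by linarith)
  rwa [show a • q + b • r + c • p = c • p + a • q + b • r by module]

theorem Covers.segment_subset {S : Set Plane} {p q r x : Plane} (h : Covers S p q r)
    (hx : x ∈ segment ℝ q r) : segment ℝ p x ⊆ S := by
  obtain ⟨b, c, hb, hc, hbc, rfl⟩ := hx
  rintro _ ⟨s, t, hs, ht, hst, rfl⟩
  have := h s (t * b) (t * c) hs (by positivity) (by positivity)
    (by rw [add_assoc, ← mul_add, hbc, mul_one, hst])
  rwa [show s • p + t • (b • q + c • r) = s • p + (t * b) • q + (t * c) • r by module]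

theorem covers_tri {S : Set Plane} {p q r : Plane} (h : 0 ≤ turn p q r) (hS : tri p q r ⊆ S) :
    Covers S p q r := by
  intro a b c ha hb hc habc
  have e (u v w : Plane) (a b c : ℝ) (habc : a + b + c = 1) :
      turn u v (a • u + b • v + c • w) = c * turn u v w := by
    obtain rfl : a = 1 - b - c := by linarith
    simp only [turn, PiLp.add_apply, PiLp.smul_apply, smul_eq_mul]
    ring
  refine hS ⟨?_, ?_, ?_⟩
  · rw [e _ _ _ _ _ _ habc]
    positivity
  · rw [show a • p + b • q + c • r = b • q + c • r + a • p by module,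
      e _ _ _ _ _ _ (by linarith), turn_rotate]
    positivity
  · rw [show a • p + b • q + c • r = c • r + a • p + b • q by module,
      e _ _ _ _ _ _ (by linarith), turn_rotate, turn_rotate]
    positivity

/-- The position of the vertices around the vertex `p3` that keeps `p3` and `p0` from crossing the
diagonals `p0 p4` and `p3 p7`. -/
structure IsLocked (p0 p1 p2 p3 p4 p7 : Plane) : Prop where
  h013 : 0 < turn p0 p1 p3
  h123 : 0 < turn p1 p2 p3
  h037 : 0 < turn p0 p3 p7
  h034 : 0 < turn p0 p3 p4
  h731 : 0 < turn p7 p3 p1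
  h032 : 0 < turn p0 p3 p2
  h324 : 0 < turn p3 p2 p4

theorem turn_pos_of_notMem {p q r : Plane} (h : 0 ≤ turn p q r) (h1 : p ∉ segment ℝ q r)
    (h2 : q ∉ segment ℝ p r) (h3 : r ∉ segment ℝ p q) : 0 < turn p q r := by
  refine h.lt_of_ne fun e => ?_
  rcases mem_segment_of_turn_eq_zero e.symm with h | h | h
  exacts [h1 h, h2 h, h3 h]

/-- This is the closedness of the lock. If an orientation vanishes, one of the three points lies
between the other two. Each case is excluded by simplicity, by a hidden pair that a covered triangle
or two collinear visible segments would make visible, or by inequalities already made strict; the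
order of the steps therefore matters. -/
theorem isLocked_of_nonneg {p0 p1 p2 p3 p4 p7 : Plane} {S : Set Plane}
    (h013 : 0 ≤ turn p0 p1 p3) (h123 : 0 ≤ turn p1 p2 p3) (h037 : 0 ≤ turn p0 p3 p7)
    (h034 : 0 ≤ turn p0 p3 p4) (h731 : 0 ≤ turn p7 p3 p1) (h032 : 0 ≤ turn p0 p3 p2)
    (h324 : 0 ≤ turn p3 p2 p4)
    (c013 : Covers S p0 p1 p3) (c123 : Covers S p1 p2 p3) (c034 : Covers S p0 p3 p4)
    (c37 : segment ℝ p3 p7 ⊆ S)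
    (n02 : ¬ segment ℝ p0 p2 ⊆ S) (n17 : ¬ segment ℝ p1 p7 ⊆ S) (n14 : ¬ segment ℝ p1 p4 ⊆ S)
    (e1 : p1 ∉ segment ℝ p2 p3) (e3 : p3 ∉ segment ℝ p1 p2) (e3' : p3 ∉ segment ℝ p0 p1)
    (e2 : p2 ∉ segment ℝ p3 p4) (e4 : p4 ∉ segment ℝ p2 p3) (e0 : p0 ∉ segment ℝ p3 p4)
    (e3'' : p3 ∉ segment ℝ p7 p0) : IsLocked p0 p1 p2 p3 p4 p7 := by
  have s03 : segment ℝ p0 p3 ⊆ S := c013.segment_subset (right_mem_segment _ _ _)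
  have s32 : segment ℝ p3 p2 ⊆ S := c123.rotate.rotate.segment_subset (right_mem_segment _ _ _)
  have s13 : segment ℝ p1 p3 ⊆ S := c123.segment_subset (right_mem_segment _ _ _)
  have k032 : 0 < turn p0 p3 p2 :=
    h032.lt_of_ne fun e => n02 (segment_subset_of_turn_eq_zero e.symm s03 s32)
  have k731 : 0 < turn p7 p3 p1 := by
    refine h731.lt_of_ne fun e => n17 (segment_subset_of_turn_eq_zero (q := p3) ?_ s13 c37)
    rw [← turn_rotate, turn_swap, ← e, neg_zero]
  have k123 : 0 < turn p1 p2 p3 := by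
    exact turn_pos_of_notMem h123 e1 (fun h => n02 (c013.segment_subset h)) e3
  have k013 : 0 < turn p0 p1 p3 := by
    refine turn_pos_of_notMem h013 (fun h => n02 ?_) (fun h => n14 ?_) e3'
    · rw [segment_symm]
      exact c123.rotate.segment_subset (by rwa [segment_symm])
    · rw [segment_symm]
      exact c034.rotate.rotate.segment_subset h
  have k324 : 0 < turn p3 p2 p4 := by
    -- If `p3` were between `p2` and `p4`, then `p2` and `p4` would lie on opposite sides of the
    -- line `p0 p3`, unless `p3 = p4`.
    refine turn_pos_of_notMem h324 (fun h => ?_) e2 (fun h => e4 (by rwa [segment_symm]))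
    obtain ⟨a, b, ha, hb, hab, e⟩ := h
    have h1 : turn p0 p3 p2 = b * turn p0 p4 p2 := by
      rw [← e, turn_combo_mid hab, turn_self_right, mul_zero, zero_add]
    have h2 : turn p0 p3 p4 = -(a * turn p0 p4 p2) := by
      rw [← e, turn_combo_mid hab, turn_self_right, turn_swap_right p0 p4 p2]
      ring
    have hT : 0 < turn p0 p4 p2 := pos_of_mul_pos_right (h1 ▸ k032) hb
    rcases ha.eq_or_lt with rfl | ha
    · obtain rfl : b = 1 := by linarith
      refine e4 ?_
      rw [← e]
      simpa using right_mem_segment ℝ p2 p4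
    · have := mul_pos ha hT
      linarith
  have k034 : 0 < turn p0 p3 p4 := by
    -- The first case, `p3` on the diagonal `p0 p4`, is what `h032` and `h324` prevent: together
    -- they put `p2` strictly to the left of `p0 p4` and make `turn p3 p2 p4` nonpositive.
    refine turn_pos_of_notMem h034 e0 (fun h => ?_)
      (fun h => n14 (c013.rotate.segment_subset (by rwa [segment_symm])))
    obtain ⟨a, b, ha, hb, hab, e⟩ := h
    have h1 : turn p0 p3 p2 = b * turn p0 p4 p2 := by
      rw [← e, turn_combo_mid hab, turn_self, mul_zero, zero_add]
    have h2 : turn p3 p2 p4 = -(a * turn p0 p4 p2) := by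
      rw [← e, turn_combo_left hab, turn_self_left, turn_swap_right p0 p4 p2]
      ring
    have hT : 0 < turn p0 p4 p2 := pos_of_mul_pos_right (h1 ▸ k032) hb
    have := mul_nonneg ha hT.le
    linarith
  have k037 : 0 < turn p0 p3 p7 := by
    -- The first case, `p0` on the diagonal `p3 p7`, is what `h731` prevents: with `p1` to the left
    -- of `p7 p3`, the triangle `p0 p1 p3` would not be counterclockwise.
    refine turn_pos_of_notMem h037 (fun h => ?_) (fun h => e3'' (by rwa [segment_symm]))
      (fun h => n17 (c013.rotate.segment_subset (by rwa [segment_symm])))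
    obtain ⟨a, b, ha, hb, hab, e⟩ := h
    have h1 : turn p0 p1 p3 = -(b * turn p7 p3 p1) := by
      rw [← e, turn_combo_left hab, turn_self_left, turn_swap_right p7 p3 p1]
      ring
    have := mul_nonneg hb k731.le
    linarith
  exact ⟨k013, k123, k037, k034, k731, k032, k324⟩

/-- Both pairs of opposite corners of the quadrilateral `0347` are locked. -/
def IsDoublyLocked (P : Polygon Plane 8) : Prop :=
  IsLocked (P 0) (P 1) (P 2) (P 3) (P 4) (P 7) ∧ IsLocked (P 4) (P 5) (P 6) (P 7) (P 0) (P 3)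

theorem IsDoublyLocked.isTriangulated {P : Polygon Plane 8} (h : IsDoublyLocked P) :
    IsTriangulated P where
  h013 := h.1.h013
  h123 := h.1.h123
  h034 := h.1.h034
  h047 := by rw [turn_rotate', turn_rotate']; exact h.2.h034
  h457 := h.2.h013
  h567 := h.2.h123

theorem IsDoublyLocked.visible_three_seven {P : Polygon Plane 8} (h : IsDoublyLocked P) :
    Visible P 3 7 :=
  h.isTriangulated.visible_three_seven h.1.h037.le (by
    rw [← turn_rotate]; exact h.2.h037.le)

theorem IsDoublyLocked.not_isDeflated {P : Polygon Plane 8} (h : IsDoublyLocked P) :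
    ¬ IsDeflated P := by
  intro hd
  have h04 : Visible P 0 4 :=
    h.isTriangulated.visible_of_notMem (by decide) (by decide) (by decide)
  have hdis := hd 0 4 3 7 (by decide) (by decide) (by decide) h04 h.visible_three_seven
  have t1 := h.1.h034
  have t2 := h.isTriangulated.h047
  have t3 := h.1.h037
  have t4 := h.2.h037
  generalize P 0 = p0, P 3 = p3, P 4 = p4, P 7 = p7 at *
  have hx : (turn p4 p7 p3 / (turn p0 p3 p7 + turn p4 p7 p3)) • p0 +
      (turn p0 p3 p7 / (turn p0 p3 p7 + turn p4 p7 p3)) • p4 ∈ openSegment ℝ p0 p4 :=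
    ⟨_, _, by positivity, by positivity, by field_simp; ring, rfl⟩
  refine disjoint_left.1 hdis hx ?_
  · refine ⟨turn p0 p4 p7 / (turn p0 p3 p4 + turn p0 p4 p7),
      turn p0 p3 p4 / (turn p0 p3 p4 + turn p0 p4 p7), by positivity, by positivity,
      by field_simp; ring, ?_⟩
    -- Either diagonal splits the quadrilateral 0347 into two triangles, with the same total area.
    have e : turn p0 p3 p4 + turn p0 p4 p7 = turn p0 p3 p7 + turn p4 p7 p3 := by
      unfold turn; ring
    rw [e]
    have hS : turn p0 p3 p7 + turn p4 p7 p3 ≠ 0 := by positivity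
    rw [← smul_right_inj hS]
    simp only [smul_add, smul_smul, mul_div_cancel₀ _ hS]
    ext i
    fin_cases i <;> simp [turn] <;> ring

/-! ### Persistence of the lock along a monotonic deformation -/

/-- For fixed barycentric coefficients the condition is closed. `tri` would not serve for limits,
since it is unbounded when its corners are collinear. -/
theorem isClosed_covers {X : Type*} [TopologicalSpace X] {γ : X → Polygon Plane n}
    (hγ : ∀ i, Continuous fun t => γ t i) (i j k : Fin n) :
    IsClosed {t | Covers (closedRegion (γ t)) (γ t i) (γ t j) (γ t k)} := by
  simp only [Covers, ofPred_forall]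
  refine isClosed_iInter fun a => isClosed_iInter fun b => isClosed_iInter fun c =>
    isClosed_iInter fun _ => isClosed_iInter fun _ => isClosed_iInter fun _ =>
    isClosed_iInter fun _ => isClosed_setOf_mem_closedRegion hγ ?_
  exact (((hγ i).const_smul a).add ((hγ j).const_smul b)).add ((hγ k).const_smul c)

theorem isClosed_visible {X : Type*} [TopologicalSpace X] {γ : X → Polygon Plane n}
    (hγ : ∀ i, Continuous fun t => γ t i) (i j : Fin n) :
    IsClosed {t | Visible (γ t) i j} := by
  have e : {t | Visible (γ t) i j} =
      {t | Covers (closedRegion (γ t)) (γ t i) (γ t j) (γ t j)} := by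
    ext t
    refine ⟨fun h a b c ha hb hc habc => h ⟨a, b + c, ha, by positivity, by linarith, by module⟩,
      ?_⟩
    rintro h _ ⟨a, b, ha, hb, hab, rfl⟩
    have := h a b 0 ha hb le_rfl (by linarith)
    rwa [zero_smul, add_zero] at this
  rw [e]
  exact isClosed_covers hγ i j j

theorem isOpen_isLocked {X : Type*} [TopologicalSpace X] {γ : X → Polygon Plane n}
    (hγ : ∀ i, Continuous fun t => γ t i) (i j k l m o : Fin n) :
    IsOpen {t | IsLocked (γ t i) (γ t j) (γ t k) (γ t l) (γ t m) (γ t o)} := by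
  have h (a b c : Fin n) : IsOpen {t | 0 < turn (γ t a) (γ t b) (γ t c)} :=
    isOpen_lt continuous_const (continuous_turn (hγ a) (hγ b) (hγ c))
  have e : {t | IsLocked (γ t i) (γ t j) (γ t k) (γ t l) (γ t m) (γ t o)} =
      {t | 0 < turn (γ t i) (γ t j) (γ t l)} ∩ {t | 0 < turn (γ t j) (γ t k) (γ t l)} ∩
      {t | 0 < turn (γ t i) (γ t l) (γ t o)} ∩ {t | 0 < turn (γ t i) (γ t l) (γ t m)} ∩
      {t | 0 < turn (γ t o) (γ t l) (γ t j)} ∩ {t | 0 < turn (γ t i) (γ t l) (γ t k)} ∩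
      {t | 0 < turn (γ t l) (γ t k) (γ t m)} := by
    ext t
    exact ⟨fun ⟨h1, h2, h3, h4, h5, h6, h7⟩ => ⟨⟨⟨⟨⟨⟨h1, h2⟩, h3⟩, h4⟩, h5⟩, h6⟩, h7⟩,
      fun ⟨⟨⟨⟨⟨⟨h1, h2⟩, h3⟩, h4⟩, h5⟩, h6⟩, h7⟩ => ⟨h1, h2, h3, h4, h5, h6, h7⟩⟩
  rw [e]
  exact ((((((h _ _ _).inter (h _ _ _)).inter (h _ _ _)).inter (h _ _ _)).inter (h _ _ _)).inter
    (h _ _ _)).inter (h _ _ _)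

/-- A simple octagon with the given hidden pairs that is a limit of doubly locked octagons is
doubly locked. -/
theorem isDoublyLocked_of_mem_closure {X : Type*} [TopologicalSpace X]
    {γ : X → Polygon Plane 8} (hγ : ∀ i, Continuous fun t => γ t i) {t : X}
    (ht : t ∈ closure {t | IsDoublyLocked (γ t)}) (hs : IsSimple (γ t))
    (hh : ∀ p ∈ hiddenPairs, ¬ Visible (γ t) p.1 p.2) : IsDoublyLocked (γ t) := by
  have lim (q : X → Prop) (hq : IsClosed {t | q t}) (h : ∀ s, IsDoublyLocked (γ s) → q s) : q t :=
    closure_minimal (fun s hs => h s hs) hq ht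
  have turns (a b c : Fin 8) (h : ∀ s, IsDoublyLocked (γ s) → 0 < turn (γ s a) (γ s b) (γ s c)) :
      0 ≤ turn (γ t a) (γ t b) (γ t c) :=
    lim _ (isClosed_le continuous_const (continuous_turn (hγ a) (hγ b) (hγ c)))
      fun s hs => (h s hs).le
  have cov (a b c : Fin 8) (h : ∀ s, IsDoublyLocked (γ s) → 0 ≤ turn (γ s a) (γ s b) (γ s c) ∧
      tri (γ s a) (γ s b) (γ s c) ⊆ triangleUnion (γ s)) :
      Covers (closedRegion (γ t)) (γ t a) (γ t b) (γ t c) :=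
    lim _ (isClosed_covers hγ a b c) fun s hs =>
      covers_tri (h s hs).1 ((h s hs).2.trans hs.isTriangulated.triangleUnion_subset)
  have v37 : Visible (γ t) 3 7 := lim _ (isClosed_visible hγ 3 7) fun s hs => hs.visible_three_seven
  have hidden (i j : Fin 8) (h : (i, j) ∈ hiddenPairs) : ¬ Visible (γ t) i j := hh (i, j) h
  have hidden' (i j : Fin 8) (h : (j, i) ∈ hiddenPairs) : ¬ Visible (γ t) i j :=
    fun hv => hh (j, i) h hv.symm
  have edge (i j : Fin 8) (h : i ≠ j ∧ i ≠ j + 1) :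
      γ t i ∉ segment ℝ (γ t j) (γ t (j + 1)) := by
    have := hs.vertex_notMem_edge i j h.1 (by rw [finRotate_apply]; exact h.2)
    rwa [finRotate_apply] at this
  constructor
  · refine isLocked_of_nonneg (S := closedRegion (γ t)) (turns _ _ _ fun s h => h.1.h013)
      (turns _ _ _ fun s h => h.1.h123)
      (turns _ _ _ fun s h => h.1.h037) (turns _ _ _ fun s h => h.1.h034)
      (turns _ _ _ fun s h => h.1.h731) (turns _ _ _ fun s h => h.1.h032)
      (turns _ _ _ fun s h => h.1.h324)
      (cov _ _ _ fun s h => ⟨h.1.h013.le, fun x hx => ?_⟩)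
      (cov _ _ _ fun s h => ⟨h.1.h123.le, fun x hx => ?_⟩)
      (cov _ _ _ fun s h => ⟨h.1.h034.le, fun x hx => ?_⟩) v37 (hidden 0 2 (by decide))
      (hidden 1 7 (by decide)) (hidden 1 4 (by decide)) (edge 1 2 (by decide))
      (edge 3 1 (by decide)) (edge 3 0 (by decide)) (edge 2 3 (by decide)) (edge 4 2 (by decide))
      (edge 0 3 (by decide)) (edge 3 7 (by decide))
    all_goals simp only [mem_triangleUnion, hx, true_or, or_true]
  -- The second lock is the first with all indices shifted by 4, which preserves the triangulation
  -- and, up to order within pairs, the hidden pairs used.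
  · refine isLocked_of_nonneg (S := closedRegion (γ t)) (turns _ _ _ fun s h => h.2.h013)
      (turns _ _ _ fun s h => h.2.h123)
      (turns _ _ _ fun s h => h.2.h037) (turns _ _ _ fun s h => h.2.h034)
      (turns _ _ _ fun s h => h.2.h731) (turns _ _ _ fun s h => h.2.h032)
      (turns _ _ _ fun s h => h.2.h324)
      (cov _ _ _ fun s h => ⟨h.2.h013.le, fun x hx => ?_⟩)
      (cov _ _ _ fun s h => ⟨h.2.h123.le, fun x hx => ?_⟩)
      (cov _ _ _ fun s h => ⟨h.2.h034.le, fun x hx => ?_⟩) v37.symm (hidden 4 6 (by decide))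
      (hidden' 5 3 (by decide)) (hidden' 5 0 (by decide)) (edge 5 6 (by decide))
      (edge 7 5 (by decide)) (edge 7 4 (by decide)) (edge 6 7 (by decide)) (edge 0 6 (by decide))
      (edge 4 7 (by decide)) (edge 7 3 (by decide))
    · simp only [mem_triangleUnion, hx, true_or, or_true]
    · simp only [mem_triangleUnion, hx, or_true]
    · rw [← tri_rotate] at hx
      rw [← tri_rotate] at hx
      simp only [mem_triangleUnion, hx, true_or, or_true]

theorem IsDoublyLocked.not_isDeflatable {P : Polygon Plane 8} (hP : IsDoublyLocked P)
    (hh : ∀ p ∈ hiddenPairs, ¬ Visible P p.1 p.2) : ¬ IsDeflatable P := by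
  rintro ⟨γ, ⟨⟨h0, hγ, hs⟩, hmono⟩, hd⟩
  have hidden (t : unitInterval) : ∀ p ∈ hiddenPairs, ¬ Visible (γ t) p.1 p.2 := by
    intro p hp hv
    refine hh p hp ?_
    rw [← h0]
    rcases (unitInterval.nonneg' (t := t)).eq_or_lt with rfl | ht
    · exact hv
    · exact hmono _ _ _ _ ht hv
  -- Open because the lock consists of strict inequalities, closed by the limit argument;
  -- connectedness of the unit interval then carries it to time 1.
  have hclopen : IsClopen {t | IsDoublyLocked (γ t)} := by
    refine ⟨closure_subset_iff_isClosed.1 fun t ht =>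
      isDoublyLocked_of_mem_closure hγ ht (hs t) (hidden t), ?_⟩
    exact (isOpen_isLocked hγ 0 1 2 3 4 7).inter (isOpen_isLocked hγ 4 5 6 7 0 3)
  have huniv := hclopen.eq_univ ⟨0, show IsDoublyLocked (γ 0) by rwa [h0]⟩
  have h1 : (1 : unitInterval) ∈ {t | IsDoublyLocked (γ t)} := by
    rw [huniv]
    exact mem_univ _
  exact IsDoublyLocked.not_isDeflated h1 hd

/-! ### Simplicity from orientation signs -/

theorem disjoint_segment_of_turn_pos {p q r s : Plane} (h1 : 0 < turn p q r)
    (h2 : 0 < turn p q s) : Disjoint (segment ℝ p q) (segment ℝ r s) := by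
  rw [disjoint_left]
  rintro _ ⟨a, b, ha, hb, hab, rfl⟩ ⟨c, d, hc, hd, hcd, e⟩
  have := congrArg (turn p q) e
  rw [turn_combo hab, turn_combo hcd, turn_self_left, turn_self_right] at this
  rcases hc.eq_or_lt with rfl | hc
  · nlinarith
  · nlinarith [mul_pos hc h1, mul_nonneg hd h2.le]

/-- One endpoint may lie on the line `r s`, as happens for edges of the visibility graph with a
common vertex; the interior points are still strictly to its left. -/
theorem disjoint_openSegment_of_turn {p q r s : Plane} (h1 : 0 ≤ turn r s p)
    (h2 : 0 ≤ turn r s q) (h3 : 0 < turn r s p + turn r s q) :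
    Disjoint (openSegment ℝ p q) (segment ℝ r s) := by
  rw [disjoint_left]
  rintro _ ⟨a, b, ha, hb, hab, rfl⟩ ⟨c, d, hc, hd, hcd, e⟩
  have := congrArg (turn r s) e
  rw [turn_combo hab, turn_combo hcd, turn_self_left, turn_self_right] at this
  rcases h1.eq_or_lt with h | h
  · rw [← h, zero_add] at h3
    nlinarith [mul_pos hb h3]
  · nlinarith [mul_pos ha h, mul_nonneg hb.le h2]

theorem eq_of_mem_segment_of_turn_ne_zero {p q r x : Plane} (h : turn p q r ≠ 0)
    (h1 : x ∈ segment ℝ p q) (h2 : x ∈ segment ℝ q r) : x = q := by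
  obtain ⟨a, b, ha, hb, hab, rfl⟩ := h1
  obtain ⟨c, d, hc, hd, hcd, e⟩ := h2
  have := congrArg (turn q r) e
  rw [turn_combo hab, turn_combo hcd, turn_self_left, turn_self_right, turn_rotate] at this
  have ha : a = 0 := by
    by_contra h0
    exact mul_ne_zero h0 h (by linarith)
  subst ha
  obtain rfl : b = 1 := by linarith
  simp

theorem isSimple_of_disjoint {P : Polygon Plane 8}
    (h1 : ∀ i : Fin 8, turn (P i) (P (i + 1)) (P (i + 1 + 1)) ≠ 0)
    (h2 : ∀ i j : Fin 8, i ≠ j → j ≠ i + 1 → i ≠ j + 1 →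
      Disjoint (segment ℝ (P i) (P (i + 1))) (segment ℝ (P j) (P (j + 1)))) : IsSimple P := by
  have hsucc (i : Fin 8) : P i ≠ P (i + 1) := fun e => h1 i (by rw [← e, turn_self])
  refine ⟨by norm_num, fun i j hij => ?_, fun i j hij x hx => ?_⟩
  · by_contra hne
    by_cases ha : j = i + 1
    · exact hsucc i (ha ▸ hij)
    by_cases hb : i = j + 1
    · exact hsucc j (hb ▸ hij.symm)
    refine disjoint_left.1 (h2 i j hne ha hb) (left_mem_segment _ _ _) ?_
    rw [hij]
    exact left_mem_segment _ _ _
  · simp only [edgeSet_eq_segment, finRotate_apply] at hx ⊢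
    by_cases ha : j = i + 1
    · subst ha
      rw [eq_of_mem_segment_of_turn_ne_zero (h1 i) hx.1 hx.2]
      simp
    by_cases hb : i = j + 1
    · subst hb
      rw [eq_of_mem_segment_of_turn_ne_zero (h1 j) hx.2 hx.1]
      simp
    exact absurd hx.2 (disjoint_left.1 (h2 i j hij ha hb) hx.1)

/-! ### Escape regions and hidden pairs -/

/-- The open region on the left of all lines `P a`, `P b` for `(a, b)` in `L` is disjoint from the
boundary curve, and stable under translation in the vertical direction `e`. -/
def IsEscape (P : Polygon Plane n) (L : List (Fin n × Fin n)) (e : ℝ) : Prop :=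
  e ≠ 0 ∧ (∀ p ∈ L, 0 ≤ (P p.2 0 - P p.1 0) * e) ∧
    ∀ i, ∃ p ∈ L, turn (P p.1) (P p.2) (P i) ≤ 0 ∧ turn (P p.1) (P p.2) (P (finRotate n i)) ≤ 0

theorem IsEscape.notMem_boundary {P : Polygon Plane n} {L : List (Fin n × Fin n)} {e : ℝ}
    (h : IsEscape P L e) {x : Plane} (hx : ∀ p ∈ L, 0 < turn (P p.1) (P p.2) x) :
    x ∉ P.boundary ℝ := by
  intro hm
  obtain ⟨i, a, b, ha, hb, hab, rfl⟩ := mem_boundary.1 hm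
  obtain ⟨p, hp, h1, h2⟩ := h.2.2 i
  have := hx p hp
  rw [turn_combo hab] at this
  nlinarith [mul_nonpos_of_nonneg_of_nonpos ha h1, mul_nonpos_of_nonneg_of_nonpos hb h2]

/-- The vertical ray from `x` in direction `e` never leaves the region, since no defining
orientation decreases along it; so it misses the boundary curve. -/
theorem IsEscape.notMem_closedRegion {P : Polygon Plane n} {L : List (Fin n × Fin n)} {e : ℝ}
    (h : IsEscape P L e) {x : Plane} (hx : ∀ p ∈ L, 0 < turn (P p.1) (P p.2) x) :
    x ∉ closedRegion P := by
  refine notMem_closedRegion_of_ray (d := !₂[0, e]) (fun h0 => h.1 ?_) fun r hr => ?_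
  · simpa using congrArg (fun v : Plane => v 1) h0
  · refine h.notMem_boundary fun p hp => ?_
    have h1 := hx p hp
    have h2 := mul_nonneg hr (h.2.1 p hp)
    have e : turn (P p.1) (P p.2) (x + r • !₂[0, e]) =
        turn (P p.1) (P p.2) x + r * ((P p.2 0 - P p.1 0) * e) := by
      simp [turn]
      ring
    rw [e]
    positivity

theorem IsEscape.not_visible {P : Polygon Plane n} {L : List (Fin n × Fin n)} {e : ℝ}
    (h : IsEscape P L e) {i j : Fin n} (a b : ℕ) (hab : 0 < a + b)
    (hx : ∀ p ∈ L, 0 < a * turn (P p.1) (P p.2) (P i) + b * turn (P p.1) (P p.2) (P j)) :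
    ¬ Visible P i j := by
  intro hv
  have hab' : (0 : ℝ) < a + b := by exact_mod_cast hab
  have hs : (a / (a + b) + b / (a + b) : ℝ) = 1 := by field_simp
  refine h.notMem_closedRegion (fun p hp => ?_) (hv ⟨a / (a + b), b / (a + b), by positivity,
    by positivity, hs, rfl⟩)
  rw [turn_combo hs]
  refine (div_pos (hx p hp) hab').trans_eq ?_
  ring

/-! ### Linear motions of one vertex and their integer certificates -/

/-- The octagon at time `t` when its vertices move linearly from `c` to `d`. -/
def octagon (c d : Fin 8 → ℤ × ℤ) (t : ℝ) : Polygon Plane 8 :=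
  ⟨fun i => !₂[(1 - t) * (c i).1 + t * (d i).1, (1 - t) * (c i).2 + t * (d i).2]⟩

/-- The orientation of three points with integer coordinates. -/
def intTurn (c : Fin 8 → ℤ × ℤ) (i j k : Fin 8) : ℤ :=
  ((c j).1 - (c i).1) * ((c k).2 - (c i).2) - ((c j).2 - (c i).2) * ((c k).1 - (c i).1)

/-- At most the vertex with index `0` moves. -/
def MovesOnlyZero (c d : Fin 8 → ℤ × ℤ) : Prop := ∀ i, i ≠ 0 → c i = d i

/-- The orientation is affine in each vertex separately, so it is affine in `t` when a single vertex
moves linearly. A sign shared by both ends thus holds throughout. -/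
theorem turn_octagon {c d : Fin 8 → ℤ × ℤ} (h : MovesOnlyZero c d) (t : ℝ) (i j k : Fin 8) :
    turn (octagon c d t i) (octagon c d t j) (octagon c d t k) =
      (1 - t) * intTurn c i j k + t * intTurn d i j k := by
  by_cases hi : i = 0 <;> by_cases hj : j = 0 <;> by_cases hk : k = 0 <;>
    simp [turn, octagon, intTurn, hi, hj, hk, h i, h j, h k] <;> ring

/-- The vertices `i j k` are in counterclockwise position, in the weak sense, in `c` and `d`. -/
def WeakLeft (c d : Fin 8 → ℤ × ℤ) (i j k : Fin 8) : Prop :=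
  0 ≤ intTurn c i j k ∧ 0 ≤ intTurn d i j k

/-- The vertices `i j k` are in counterclockwise position in `c` and `d`. -/
def StrictLeft (c d : Fin 8 → ℤ × ℤ) (i j k : Fin 8) : Prop :=
  0 < intTurn c i j k ∧ 0 < intTurn d i j k

instance (c d : Fin 8 → ℤ × ℤ) (i j k : Fin 8) : Decidable (WeakLeft c d i j k) :=
  inferInstanceAs (Decidable (_ ∧ _))

instance (c d : Fin 8 → ℤ × ℤ) (i j k : Fin 8) : Decidable (StrictLeft c d i j k) :=
  inferInstanceAs (Decidable (_ ∧ _))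

/-- The segment `k l` lies on the left of the segment `i j`, and does not lie on the same line. -/
def SideLeft (c d : Fin 8 → ℤ × ℤ) (i j k l : Fin 8) : Prop :=
  WeakLeft c d i j k ∧ WeakLeft c d i j l ∧ (StrictLeft c d i j k ∨ StrictLeft c d i j l)

instance (c d : Fin 8 → ℤ × ℤ) (i j k l : Fin 8) : Decidable (SideLeft c d i j k l) :=
  inferInstanceAs (Decidable (_ ∧ _))

instance (c d : Fin 8 → ℤ × ℤ) : Decidable (MovesOnlyZero c d) :=
  inferInstanceAs (Decidable (∀ _, _))

theorem convex_combo_pos {a b t : ℝ} (h0 : 0 ≤ t) (h1 : t ≤ 1) (ha : 0 < a) (hb : 0 < b) :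
    0 < (1 - t) * a + t * b := by
  rcases h0.eq_or_lt with rfl | h0
  · simpa
  · have := mul_pos h0 hb
    have := mul_nonneg (sub_nonneg.2 h1) ha.le
    linarith

theorem convex_combo_nonneg {a b t : ℝ} (h0 : 0 ≤ t) (h1 : t ≤ 1) (ha : 0 ≤ a) (hb : 0 ≤ b) :
    0 ≤ (1 - t) * a + t * b :=
  add_nonneg (mul_nonneg (sub_nonneg.2 h1) ha) (mul_nonneg h0 hb)

theorem StrictLeft.turn_pos {c d : Fin 8 → ℤ × ℤ} {i j k : Fin 8} (hs : StrictLeft c d i j k)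
    (h : MovesOnlyZero c d) {t : ℝ} (ht : t ∈ Icc (0 : ℝ) 1) :
    0 < turn (octagon c d t i) (octagon c d t j) (octagon c d t k) := by
  rw [turn_octagon h]
  exact convex_combo_pos ht.1 ht.2 (by exact_mod_cast hs.1) (by exact_mod_cast hs.2)

theorem WeakLeft.turn_nonneg {c d : Fin 8 → ℤ × ℤ} {i j k : Fin 8} (hs : WeakLeft c d i j k)
    (h : MovesOnlyZero c d) {t : ℝ} (ht : t ∈ Icc (0 : ℝ) 1) :
    0 ≤ turn (octagon c d t i) (octagon c d t j) (octagon c d t k) := by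
  rw [turn_octagon h]
  exact convex_combo_nonneg ht.1 ht.2 (by exact_mod_cast hs.1) (by exact_mod_cast hs.2)

theorem SideLeft.disjoint {c d : Fin 8 → ℤ × ℤ} {i j k l : Fin 8} (hs : SideLeft c d i j k l)
    (h : MovesOnlyZero c d) {t : ℝ} (ht : t ∈ Icc (0 : ℝ) 1) :
    Disjoint (openSegment ℝ (octagon c d t k) (octagon c d t l))
      (segment ℝ (octagon c d t i) (octagon c d t j)) := by
  have h1 := hs.1.turn_nonneg h ht
  have h2 := hs.2.1.turn_nonneg h ht
  refine disjoint_openSegment_of_turn h1 h2 ?_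
  rcases hs.2.2 with h3 | h3
  · exact add_pos_of_pos_of_nonneg (h3.turn_pos h ht) h2
  · exact add_pos_of_nonneg_of_pos h1 (h3.turn_pos h ht)

/-- Decidable sufficient condition for the octagons between `c` and `d` to be simple. -/
def SimpleCert (c d : Fin 8 → ℤ × ℤ) : Prop :=
  (∀ i : Fin 8, StrictLeft c d i (i + 1) (i + 1 + 1) ∨ StrictLeft c d (i + 1) i (i + 1 + 1)) ∧
  ∀ i j : Fin 8, i ≠ j → j ≠ i + 1 → i ≠ j + 1 →
    (StrictLeft c d i (i + 1) j ∧ StrictLeft c d i (i + 1) (j + 1)) ∨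
    (StrictLeft c d (i + 1) i j ∧ StrictLeft c d (i + 1) i (j + 1)) ∨
    (StrictLeft c d j (j + 1) i ∧ StrictLeft c d j (j + 1) (i + 1)) ∨
    (StrictLeft c d (j + 1) j i ∧ StrictLeft c d (j + 1) j (i + 1))

instance (c d : Fin 8 → ℤ × ℤ) : Decidable (SimpleCert c d) :=
  inferInstanceAs (Decidable (_ ∧ _))

theorem SimpleCert.isSimple {c d : Fin 8 → ℤ × ℤ} (hc : SimpleCert c d) (h : MovesOnlyZero c d)
    {t : ℝ} (ht : t ∈ Icc (0 : ℝ) 1) : IsSimple (octagon c d t) := by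
  refine isSimple_of_disjoint (fun i => ?_) fun i j h1 h2 h3 => ?_
  · rcases hc.1 i with h1 | h1
    · exact (h1.turn_pos h ht).ne'
    · rw [turn_swap, neg_ne_zero]
      exact (h1.turn_pos h ht).ne'
  · rcases hc.2 i j h1 h2 h3 with ⟨a, b⟩ | ⟨a, b⟩ | ⟨a, b⟩ | ⟨a, b⟩
    · exact disjoint_segment_of_turn_pos (a.turn_pos h ht) (b.turn_pos h ht)
    · rw [segment_symm ℝ (octagon c d t i)]
      exact disjoint_segment_of_turn_pos (a.turn_pos h ht) (b.turn_pos h ht)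
    · exact (disjoint_segment_of_turn_pos (a.turn_pos h ht) (b.turn_pos h ht)).symm
    · rw [segment_symm ℝ (octagon c d t j)]
      exact (disjoint_segment_of_turn_pos (a.turn_pos h ht) (b.turn_pos h ht)).symm

/-- Decidable sufficient condition for the octagons between `c` and `d` to be triangulated. -/
def TriangulatedCert (c d : Fin 8 → ℤ × ℤ) : Prop :=
  StrictLeft c d 0 1 3 ∧ StrictLeft c d 1 2 3 ∧ StrictLeft c d 0 3 4 ∧ StrictLeft c d 0 4 7 ∧
    StrictLeft c d 4 5 7 ∧ StrictLeft c d 5 6 7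

instance (c d : Fin 8 → ℤ × ℤ) : Decidable (TriangulatedCert c d) :=
  inferInstanceAs (Decidable (_ ∧ _))

theorem TriangulatedCert.isTriangulated {c d : Fin 8 → ℤ × ℤ} (hc : TriangulatedCert c d)
    (h : MovesOnlyZero c d) {t : ℝ} (ht : t ∈ Icc (0 : ℝ) 1) : IsTriangulated (octagon c d t) :=
  ⟨hc.1.turn_pos h ht, hc.2.1.turn_pos h ht, hc.2.2.1.turn_pos h ht, hc.2.2.2.1.turn_pos h ht,
    hc.2.2.2.2.1.turn_pos h ht, hc.2.2.2.2.2.turn_pos h ht⟩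

/-- Decidable sufficient condition for `IsEscape`. -/
def EscapeCert (c d : Fin 8 → ℤ × ℤ) (L : List (Fin 8 × Fin 8)) (e : ℤ) : Prop :=
  e ≠ 0 ∧ (∀ p ∈ L, 0 ≤ ((c p.2).1 - (c p.1).1) * e ∧ 0 ≤ ((d p.2).1 - (d p.1).1) * e) ∧
    ∀ i : Fin 8, ∃ p ∈ L, WeakLeft c d p.2 p.1 i ∧ WeakLeft c d p.2 p.1 (i + 1)

instance (c d : Fin 8 → ℤ × ℤ) (L : List (Fin 8 × Fin 8)) (e : ℤ) :
    Decidable (EscapeCert c d L e) :=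
  inferInstanceAs (Decidable (_ ∧ _))

theorem EscapeCert.isEscape {c d : Fin 8 → ℤ × ℤ} {L : List (Fin 8 × Fin 8)} {e : ℤ}
    (hc : EscapeCert c d L e) (h : MovesOnlyZero c d) {t : ℝ} (ht : t ∈ Icc (0 : ℝ) 1) :
    IsEscape (octagon c d t) L e := by
  refine ⟨by exact_mod_cast hc.1, fun p hp => ?_, fun i => ?_⟩
  · have h1 : (0 : ℝ) ≤ ((c p.2).1 - (c p.1).1) * e := by exact_mod_cast (hc.2.1 p hp).1
    have h2 : (0 : ℝ) ≤ ((d p.2).1 - (d p.1).1) * e := by exact_mod_cast (hc.2.1 p hp).2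
    refine (convex_combo_nonneg ht.1 ht.2 h1 h2).trans_eq ?_
    simp only [octagon, PiLp.toLp_apply, Matrix.cons_val_zero]
    ring
  · obtain ⟨p, hp, h1, h2⟩ := hc.2.2 i
    refine ⟨p, hp, ?_, ?_⟩
    · rw [turn_swap, neg_nonpos]
      exact h1.turn_nonneg h ht
    · rw [turn_swap, neg_nonpos, finRotate_apply]
      exact h2.turn_nonneg h ht

/-- Decidable sufficient condition for the weighted mean of the vertices `i` and `j`, with
weights `a` and `b`, to lie in the escape region of `L`. -/
def HiddenCert (c d : Fin 8 → ℤ × ℤ) (L : List (Fin 8 × Fin 8)) (i j : Fin 8) (a b : ℕ) : Prop :=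
  0 < a + b ∧ ∀ p ∈ L, 0 < a * intTurn c p.1 p.2 i + b * intTurn c p.1 p.2 j ∧
    0 < a * intTurn d p.1 p.2 i + b * intTurn d p.1 p.2 j

instance (c d : Fin 8 → ℤ × ℤ) (L : List (Fin 8 × Fin 8)) (i j : Fin 8) (a b : ℕ) :
    Decidable (HiddenCert c d L i j a b) :=
  inferInstanceAs (Decidable (_ ∧ _))

theorem HiddenCert.not_visible {c d : Fin 8 → ℤ × ℤ} {L : List (Fin 8 × Fin 8)} {i j : Fin 8}
    {a b : ℕ} (hc : HiddenCert c d L i j a b) {e : ℤ} (he : EscapeCert c d L e)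
    (h : MovesOnlyZero c d) {t : ℝ} (ht : t ∈ Icc (0 : ℝ) 1) : ¬ Visible (octagon c d t) i j := by
  refine (he.isEscape h ht).not_visible a b hc.1 fun p hp => ?_
  have h1 : (0 : ℝ) < a * intTurn c p.1 p.2 i + b * intTurn c p.1 p.2 j := by
    exact_mod_cast (hc.2 p hp).1
  have h2 : (0 : ℝ) < a * intTurn d p.1 p.2 i + b * intTurn d p.1 p.2 j := by
    exact_mod_cast (hc.2 p hp).2
  rw [turn_octagon h, turn_octagon h]
  refine (convex_combo_pos ht.1 ht.2 h1 h2).trans_eq ?_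
  ring

/-- The pairs of vertices that see each other in every triangulated octagon. -/
def visiblePairs : List (Fin 8 × Fin 8) :=
  [(0, 1), (1, 2), (2, 3), (3, 4), (4, 5), (5, 6), (6, 7), (0, 7), (1, 3), (0, 3), (0, 4), (4, 7),
    (5, 7)]

/-- Decidable sufficient condition for the open diagonals to avoid the boundary. -/
def DiagonalCert (c d : Fin 8 → ℤ × ℤ) : Prop :=
  ∀ p ∈ [((1 : Fin 8), (3 : Fin 8)), (0, 3), (0, 4), (4, 7), (5, 7), (3, 7)], ∀ k : Fin 8,
    SideLeft c d k (k + 1) p.1 p.2 ∨ SideLeft c d (k + 1) k p.1 p.2 ∨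
    (StrictLeft c d p.1 p.2 k ∧ StrictLeft c d p.1 p.2 (k + 1)) ∨
    (StrictLeft c d p.2 p.1 k ∧ StrictLeft c d p.2 p.1 (k + 1))

instance (c d : Fin 8 → ℤ × ℤ) : Decidable (DiagonalCert c d) :=
  inferInstanceAs (Decidable (∀ _, _))

theorem DiagonalCert.generalPosition {c d : Fin 8 → ℤ × ℤ} (hc : DiagonalCert c d)
    (h : MovesOnlyZero c d) {t : ℝ} (ht : t ∈ Icc (0 : ℝ) 1)
    (hh : ∀ p ∈ hiddenPairs, ¬ Visible (octagon c d t) p.1 p.2) :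
    GeneralPosition (octagon c d t) := by
  have key : ∀ i j : Fin 8, i < j → ¬ Adjacent i j → (i, j) ∉ hiddenPairs →
      (i, j) ∈ [((1 : Fin 8), (3 : Fin 8)), (0, 3), (0, 4), (4, 7), (5, 7), (3, 7)] := by
    simp only [Adjacent, finRotate_apply]
    decide
  have main : ∀ i j : Fin 8, i < j → IsDiagonal (octagon c d t) i j →
      openSegment ℝ (octagon c d t i) (octagon c d t j) ⊆ openRegion (octagon c d t) := by
    rintro i j hij ⟨-, ha, hv⟩ x hx
    refine ((openSegment_subset_segment ℝ _ _).trans hv hx).resolve_left fun hb => ?_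
    obtain ⟨k, hk⟩ := mem_boundary.1 hb
    rw [finRotate_apply] at hk
    have hx' := openSegment_subset_segment ℝ _ _ hx
    rcases hc (i, j) (key i j hij ha fun hm => hh _ hm hv) k with h1 | h1 | ⟨h1, h2⟩ | ⟨h1, h2⟩
    · exact disjoint_left.1 (h1.disjoint h ht) hx hk
    · exact disjoint_left.1 (h1.disjoint h ht) hx (by rwa [segment_symm])
    · exact disjoint_left.1 (disjoint_segment_of_turn_pos (h1.turn_pos h ht) (h2.turn_pos h ht))
        hx' hk
    · exact disjoint_left.1 (disjoint_segment_of_turn_pos (h1.turn_pos h ht) (h2.turn_pos h ht))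
        (by rwa [segment_symm]) hk
  intro i j hd
  rcases lt_or_gt_of_ne hd.1 with hij | hij
  · exact main i j hij hd
  · rw [openSegment_symm]
    exact main j i hij ⟨hd.1.symm, fun ha => hd.2.1 (Or.symm ha), hd.2.2.symm⟩

/-- Decidable sufficient condition for the edges of the visibility graph not to cross. -/
def DeflatedCert (c d : Fin 8 → ℤ × ℤ) : Prop :=
  ∀ p ∈ visiblePairs, ∀ q ∈ visiblePairs, p ≠ q →
    SideLeft c d p.1 p.2 q.1 q.2 ∨ SideLeft c d p.2 p.1 q.1 q.2 ∨
    SideLeft c d q.1 q.2 p.1 p.2 ∨ SideLeft c d q.2 q.1 p.1 p.2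

instance (c d : Fin 8 → ℤ × ℤ) : Decidable (DeflatedCert c d) :=
  inferInstanceAs (Decidable (∀ _, _))

theorem DeflatedCert.isDeflated {c d : Fin 8 → ℤ × ℤ} (hc : DeflatedCert c d)
    (h : MovesOnlyZero c d) {t : ℝ} (ht : t ∈ Icc (0 : ℝ) 1)
    (hh : ∀ p ∈ hiddenPairs, ¬ Visible (octagon c d t) p.1 p.2)
    (h37 : ¬ Visible (octagon c d t) 3 7) : IsDeflated (octagon c d t) := by
  have key : ∀ i j : Fin 8, i < j → (i, j) ∉ hiddenPairs → (i, j) ≠ (3, 7) →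
      (i, j) ∈ visiblePairs := by decide
  have pair (i j : Fin 8) (hij : i ≠ j) (hv : Visible (octagon c d t) i j) :
      ∃ p ∈ visiblePairs, s(i, j) = s(p.1, p.2) ∧
        openSegment ℝ (octagon c d t i) (octagon c d t j) =
          openSegment ℝ (octagon c d t p.1) (octagon c d t p.2) := by
    rcases lt_or_gt_of_ne hij with hij | hij
    · refine ⟨(i, j), key i j hij (fun hm => hh _ hm hv) fun e => ?_, rfl, rfl⟩
      simp only [Prod.mk.injEq] at e
      obtain ⟨rfl, rfl⟩ := e
      exact h37 hv
    · refine ⟨(j, i), key j i hij (fun hm => hh _ hm hv.symm) fun e => ?_, Sym2.eq_swap,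
        openSegment_symm ℝ _ _⟩
      simp only [Prod.mk.injEq] at e
      obtain ⟨rfl, rfl⟩ := e
      exact h37 hv.symm
  intro i j k l hij hkl hne hv1 hv2
  obtain ⟨p, hp, ep, ep'⟩ := pair i j hij hv1
  obtain ⟨q, hq, eq, eq'⟩ := pair k l hkl hv2
  rw [ep', eq']
  have hpq : p ≠ q := by
    rintro rfl
    exact hne (ep.trans eq.symm)
  rcases hc p hp q hq hpq with h1 | h1 | h1 | h1
  · exact ((h1.disjoint h ht).mono_right (openSegment_subset_segment ℝ _ _)).symm
  · rw [openSegment_symm ℝ (octagon c d t p.1)]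
    exact ((h1.disjoint h ht).mono_right (openSegment_subset_segment ℝ _ _)).symm
  · exact (h1.disjoint h ht).mono_right (openSegment_subset_segment ℝ _ _)
  · rw [openSegment_symm ℝ (octagon c d t q.1)]
    exact (h1.disjoint h ht).mono_right (openSegment_subset_segment ℝ _ _)

/-! ### The two octagons -/

/-- The vertices of an octagon that is not deflatable. -/
def lockedCoords : Fin 8 → ℤ × ℤ :=
  ![(0, -6), (10, 2), (4, 12), (2, 0), (0, 6), (-10, -2), (-4, -12), (-2, 0)]

/-- The vertices of a deflatable octagon. -/
def startCoords : Fin 8 → ℤ × ℤ :=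
  ![(0, -1), (4, -14), (6, 9), (2, 0), (1, 8), (-7, -8), (-3, -4), (-2, 0)]

/-- The vertices of its deflation. -/
def endCoords : Fin 8 → ℤ × ℤ :=
  ![(0, 1), (4, -14), (6, 9), (2, 0), (1, 8), (-7, -8), (-3, -4), (-2, 0)]

/-- The octagon that is not deflatable. -/
def lockedOctagon : Polygon Plane 8 := octagon lockedCoords lockedCoords 0

/-- The linear motion of the deflatable octagon. -/
def movingOctagon (t : ℝ) : Polygon Plane 8 := octagon startCoords endCoords t

theorem movesOnlyZero_refl (c : Fin 8 → ℤ × ℤ) : MovesOnlyZero c c := fun _ _ => rfl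

theorem movesOnlyZero_start_end : MovesOnlyZero startCoords endCoords := by decide

theorem octagon_zero (c d : Fin 8 → ℤ × ℤ) : octagon c d 0 = octagon c c 0 := by
  simp [octagon]

theorem octagon_one (c d : Fin 8 → ℤ × ℤ) : octagon c d 1 = octagon d d 0 := by
  simp [octagon]

theorem zero_mem_Icc : (0 : ℝ) ∈ Icc (0 : ℝ) 1 := ⟨le_rfl, zero_le_one⟩

theorem one_mem_Icc : (1 : ℝ) ∈ Icc (0 : ℝ) 1 := ⟨zero_le_one, le_rfl⟩

theorem lockedOctagon_hidden : ∀ p ∈ hiddenPairs, ¬ Visible lockedOctagon p.1 p.2 := by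
  -- The outer pockets at the reflex vertices 3, opening upwards, and 7, opening downwards. They are
  -- exchanged by the point reflection of this octagon in the origin, which shifts indices by 4. The
  -- numbers in the list below are the weights of a point of each segment inside a pocket.
  have up : EscapeCert lockedCoords lockedCoords [(4, 3), (3, 2), (0, 1)] 1 := by decide
  have down : EscapeCert lockedCoords lockedCoords [(7, 6), (0, 7), (4, 5)] (-1) := by decide
  have hu (i j : Fin 8) (a b : ℕ)
      (hc : HiddenCert lockedCoords lockedCoords [(4, 3), (3, 2), (0, 1)] i j a b) :
      ¬ Visible lockedOctagon i j := hc.not_visible up (movesOnlyZero_refl _) zero_mem_Icc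
  have hd (i j : Fin 8) (a b : ℕ)
      (hc : HiddenCert lockedCoords lockedCoords [(7, 6), (0, 7), (4, 5)] i j a b) :
      ¬ Visible lockedOctagon i j := hc.not_visible down (movesOnlyZero_refl _) zero_mem_Icc
  simp only [hiddenPairs, List.forall_mem_cons]
  exact ⟨hu 0 2 1 1 (by decide), hd 0 5 9 1 (by decide), hd 0 6 1 1 (by decide),
    hu 1 4 1 3 (by decide), hu 1 5 3 2 (by decide), hd 1 6 1 3 (by decide),
    hu 1 7 1 2 (by decide), hu 2 4 1 1 (by decide), hu 2 5 3 1 (by decide),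
    hu 2 6 3 1 (by decide), hu 2 7 1 1 (by decide), hd 3 5 2 1 (by decide),
    hd 3 6 1 1 (by decide), hd 4 6 1 3 (by decide), by simp⟩

theorem movingOctagon_escape :
    EscapeCert startCoords endCoords [(7, 6), (0, 7), (1, 0), (4, 5)] (-1) := by decide

theorem movingOctagon_hidden {t : ℝ} (ht : t ∈ Icc (0 : ℝ) 1) :
    ∀ p ∈ hiddenPairs, ¬ Visible (movingOctagon t) p.1 p.2 := by
  have up : EscapeCert startCoords endCoords [(4, 3), (3, 2), (0, 1)] 1 := by decide
  have hu (i j : Fin 8) (a b : ℕ)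
      (hc : HiddenCert startCoords endCoords [(4, 3), (3, 2), (0, 1)] i j a b) :
      ¬ Visible (movingOctagon t) i j := hc.not_visible up movesOnlyZero_start_end ht
  have hd (i j : Fin 8) (a b : ℕ)
      (hc : HiddenCert startCoords endCoords [(7, 6), (0, 7), (1, 0), (4, 5)] i j a b) :
      ¬ Visible (movingOctagon t) i j :=
    hc.not_visible movingOctagon_escape movesOnlyZero_start_end ht
  simp only [hiddenPairs, List.forall_mem_cons]
  exact ⟨hu 0 2 1 1 (by decide), hd 0 5 9 1 (by decide), hd 0 6 1 1 (by decide),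
    hu 1 4 1 3 (by decide), hd 1 5 1 1 (by decide), hd 1 6 1 3 (by decide),
    hd 1 7 1 1 (by decide), hu 2 4 1 1 (by decide), hu 2 5 3 1 (by decide),
    hu 2 6 3 1 (by decide), hu 2 7 1 1 (by decide), hd 3 5 2 1 (by decide),
    hd 3 6 1 1 (by decide), hd 4 6 1 3 (by decide), by simp⟩

theorem movingOctagon_isSimple {t : ℝ} (ht : t ∈ Icc (0 : ℝ) 1) : IsSimple (movingOctagon t) :=
  SimpleCert.isSimple (by decide) movesOnlyZero_start_end ht

theorem movingOctagon_isTriangulated {t : ℝ} (ht : t ∈ Icc (0 : ℝ) 1) :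
    IsTriangulated (movingOctagon t) :=
  TriangulatedCert.isTriangulated (by decide) movesOnlyZero_start_end ht

theorem movingOctagon_visible_three_seven_iff {t : ℝ} (ht : t ∈ Icc (0 : ℝ) 1) :
    Visible (movingOctagon t) 3 7 ↔ t ≤ 1 / 2 := by
  constructor
  · intro hv
    by_contra! hlt
    refine (movingOctagon_escape.isEscape movesOnlyZero_start_end ht).not_visible 1 3 (by norm_num)
      ?_ hv
    simp only [turn_octagon movesOnlyZero_start_end, List.forall_mem_cons,
      show intTurn startCoords 7 6 3 = 16 from by decide,
      show intTurn endCoords 7 6 3 = 16 from by decide,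
      show intTurn startCoords 7 6 7 = 0 from by decide,
      show intTurn endCoords 7 6 7 = 0 from by decide,
      show intTurn startCoords 0 7 3 = -4 from by decide,
      show intTurn endCoords 0 7 3 = 4 from by decide,
      show intTurn startCoords 0 7 7 = 0 from by decide,
      show intTurn endCoords 0 7 7 = 0 from by decide,
      show intTurn startCoords 1 0 3 = -30 from by decide,
      show intTurn endCoords 1 0 3 = -26 from by decide,
      show intTurn startCoords 1 0 7 = 22 from by decide,
      show intTurn endCoords 1 0 7 = 34 from by decide,
      show intTurn startCoords 4 5 3 = 80 from by decide,
      show intTurn endCoords 4 5 3 = 80 from by decide,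
      show intTurn startCoords 4 5 7 = 16 from by decide,
      show intTurn endCoords 4 5 7 = 16 from by decide]
    refine ⟨?_, ?_, ?_, ?_, by simp⟩ <;> push_cast <;> linarith [ht.1, ht.2]
  · intro hle
    refine (movingOctagon_isTriangulated ht).visible_three_seven ?_ ?_ <;>
      simp only [movingOctagon, turn_octagon movesOnlyZero_start_end,
      show intTurn startCoords 0 3 7 = 4 from by decide,
      show intTurn endCoords 0 3 7 = -4 from by decide,
      show intTurn startCoords 3 4 7 = 32 from by decide,
      show intTurn endCoords 3 4 7 = 32 from by decide] <;>
      push_cast <;> linarith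

theorem lockedOctagon_isDoublyLocked : IsDoublyLocked lockedOctagon := by
  have h (i j k : Fin 8) (hs : StrictLeft lockedCoords lockedCoords i j k) :
      0 < turn (lockedOctagon i) (lockedOctagon j) (lockedOctagon k) :=
    hs.turn_pos (movesOnlyZero_refl _) zero_mem_Icc
  refine ⟨⟨?_, ?_, ?_, ?_, ?_, ?_, ?_⟩, ⟨?_, ?_, ?_, ?_, ?_, ?_, ?_⟩⟩ <;>
    exact h _ _ _ (by decide)

theorem lockedOctagon_isSimple : IsSimple lockedOctagon :=
  SimpleCert.isSimple (by decide) (movesOnlyZero_refl _) zero_mem_Icc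

theorem lockedOctagon_generalPosition : GeneralPosition lockedOctagon :=
  DiagonalCert.generalPosition (by decide) (movesOnlyZero_refl _) zero_mem_Icc lockedOctagon_hidden

theorem movingOctagon_zero_generalPosition : GeneralPosition (movingOctagon 0) := by
  have hh := movingOctagon_hidden zero_mem_Icc
  -- The certificate is checked for the motionless initial octagon, because it fails for 37 at the
  -- final position.
  rw [movingOctagon, octagon_zero] at *
  exact DiagonalCert.generalPosition (by decide) (movesOnlyZero_refl _) zero_mem_Icc hh

theorem movingOctagon_one_isDeflated : IsDeflated (movingOctagon 1) := by
  have hh := movingOctagon_hidden one_mem_Icc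
  have h37 : ¬ Visible (movingOctagon 1) 3 7 := by
    rw [movingOctagon_visible_three_seven_iff one_mem_Icc]
    norm_num
  rw [movingOctagon, octagon_one] at *
  exact DeflatedCert.isDeflated (by decide +kernel) (movesOnlyZero_refl _) zero_mem_Icc hh h37

theorem continuous_movingOctagon (i : Fin 8) : Continuous fun t => movingOctagon t i := by
  unfold movingOctagon octagon
  refine (PiLp.continuous_toLp 2 _).comp (continuous_pi fun k => ?_)
  fin_cases k <;> simp <;> fun_prop

theorem forall_of_symm {p : Fin 8 → Fin 8 → Prop} (hr : ∀ i, p i i) (hs : ∀ i j, p i j → p j i)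
    (h : ∀ i j, i < j → p i j) (i j : Fin 8) : p i j := by
  rcases lt_trichotomy i j with hij | rfl | hij
  · exact h i j hij
  · exact hr i
  · exact hs _ _ (h j i hij)

/-- Monotonicity holds because the triangulation and the hidden pairs persist at all times, while 37
is visible exactly up to time 1/2. -/
theorem movingOctagon_isDeflation :
    IsDeflation (movingOctagon 0) fun t : unitInterval => movingOctagon t := by
  refine ⟨⟨⟨by simp, fun i => (continuous_movingOctagon i).comp continuous_subtype_val,
    fun t => movingOctagon_isSimple t.2⟩, fun i j s t hst => ?_⟩, by
      simpa using movingOctagon_one_isDeflated⟩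
  revert i j
  refine forall_of_symm (fun i _ => visible_self _ i) (fun i j h hv => (h hv.symm).symm) ?_
  intro i j hij hv
  by_cases h37 : (i, j) = (3, 7)
  · simp only [Prod.mk.injEq] at h37
    obtain ⟨rfl, rfl⟩ := h37
    rw [movingOctagon_visible_three_seven_iff s.2]
    rw [movingOctagon_visible_three_seven_iff t.2] at hv
    exact (Subtype.coe_le_coe.2 hst.le).trans hv
  · exact (movingOctagon_isTriangulated s.2).visible_of_notMem hij
      (fun hm => movingOctagon_hidden t.2 (i, j) hm hv) h37

theorem lockedOctagon_visible_iff (i j : Fin 8) :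
    Visible lockedOctagon i j ↔ Visible (movingOctagon 0) i j := by
  revert i j
  refine forall_of_symm (fun i => iff_of_true (visible_self _ i) (visible_self _ i))
    (fun i j h => ⟨fun hv => (h.1 hv.symm).symm, fun hv => (h.2 hv.symm).symm⟩) ?_
  intro i j hij
  by_cases h37 : (i, j) = (3, 7)
  · simp only [Prod.mk.injEq] at h37
    obtain ⟨rfl, rfl⟩ := h37
    refine iff_of_true lockedOctagon_isDoublyLocked.visible_three_seven ?_
    rw [movingOctagon_visible_three_seven_iff zero_mem_Icc]
    norm_num
  · by_cases hm : (i, j) ∈ hiddenPairs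
    · exact iff_of_false (lockedOctagon_hidden (i, j) hm) (movingOctagon_hidden zero_mem_Icc (i, j) hm)
    · exact iff_of_true
        (lockedOctagon_isDoublyLocked.isTriangulated.visible_of_notMem hij hm h37)
        ((movingOctagon_isTriangulated zero_mem_Icc).visible_of_notMem hij hm h37)

theorem movingOctagon_movesOnlyThrough :
    MovesOnlyThrough (movingOctagon 0) (fun t : unitInterval => movingOctagon t) 0 3 7 := by
  have e0 : movingOctagon 0 0 = !₂[(0 : ℝ), -1] := by
    simp [movingOctagon, octagon, startCoords]
  have e1 : movingOctagon 1 0 = !₂[(0 : ℝ), 1] := by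
    simp [movingOctagon, octagon, endCoords]
  have e3 : movingOctagon 0 3 = !₂[(2 : ℝ), 0] := by
    simp [movingOctagon, octagon, startCoords]
  have e7 : movingOctagon 0 7 = !₂[(-2 : ℝ), 0] := by
    simp [movingOctagon, octagon, startCoords]
  have hmid : (!₂[0, 0] : Plane) ∈ openSegment ℝ (movingOctagon 0 3) (movingOctagon 0 7) := by
    rw [e3, e7]
    refine ⟨1 / 2, 1 / 2, by norm_num, by norm_num, by norm_num, ?_⟩
    ext k
    fin_cases k <;> norm_num
  refine ⟨fun t i hi => ?_, ⟨by decide, ?_, ?_⟩, ⟨⟨1 / 2, by norm_num, by norm_num⟩, ?_⟩, ?_⟩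
  · have := movesOnlyZero_start_end i hi
    simp only [movingOctagon, octagon, this]
    congr 1
    ext k
    fin_cases k <;> simp <;> ring
  · simp only [Adjacent, finRotate_apply]
    decide
  · rw [movingOctagon_visible_three_seven_iff zero_mem_Icc]
    norm_num
  · convert hmid using 1
    ext k
    fin_cases k <;> norm_num [movingOctagon, octagon, startCoords, endCoords]
  -- The initial and final positions `(0, -1)` and `(0, 1)` are reflections of each other in the
  -- origin, the midpoint of 37, which gives strictly opposite sides.
  · have hr : movingOctagon 1 0 = AffineEquiv.pointReflection ℝ !₂[0, 0] (movingOctagon 0 0) := by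
      rw [e0, e1, AffineEquiv.pointReflection_apply]
      ext k
      fin_cases k <;> simp
    have hs := openSegment_subset_segment ℝ _ _ hmid
    change (affineSpan ℝ _).SOppSide _ (movingOctagon ((1 : unitInterval) : ℝ) 0)
    rw [Set.Icc.coe_one, hr]
    refine AffineSubspace.sOppSide_pointReflection ?_ fun hm => ?_
    · exact (mem_segment_iff_wbtw.1 hs).mem_affineSpan
    · obtain ⟨r, h⟩ := mem_affineSpan_pair_iff_exists_lineMap_eq.1 hm
      rw [e0, e3, e7] at h
      have := congrArg (fun v : Plane => v 1) h
      simp [AffineMap.lineMap_apply] at this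

end PolygonDeflation

theorem mainTheorem8 :
    ∃ (n : ℕ) (P Q : Polygon PolygonDeflation.Plane n),
      PolygonDeflation.IsSimple P ∧ PolygonDeflation.GeneralPosition P ∧
      PolygonDeflation.IsSimple Q ∧ PolygonDeflation.GeneralPosition Q ∧
      (∀ i j : Fin n, PolygonDeflation.Visible P i j ↔ PolygonDeflation.Visible Q i j) ∧
      ¬ PolygonDeflation.IsDeflatable P ∧
      PolygonDeflation.IsDeflatable Q ∧
      ∃ (γ : unitInterval → Polygon PolygonDeflation.Plane n) (u a b : Fin n),
        PolygonDeflation.IsDeflation Q γ ∧ PolygonDeflation.MovesOnlyThrough Q γ u a b := by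
  open PolygonDeflation in
  exact ⟨8, lockedOctagon, movingOctagon 0, lockedOctagon_isSimple, lockedOctagon_generalPosition,
    movingOctagon_isSimple zero_mem_Icc, movingOctagon_zero_generalPosition,
    lockedOctagon_visible_iff,
    lockedOctagon_isDoublyLocked.not_isDeflatable lockedOctagon_hidden,
    ⟨_, movingOctagon_isDeflation⟩, _, 0, 3, 7, movingOctagon_isDeflation,
    movingOctagon_movesOnlyThrough⟩
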